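/- A \emph{flat disk} is a metric space $D$ homeomorphic to the closed unit disk in which every point $p$ has, for some $\rho>0$ and some $\theta_p>0$, an open ball $B(p,\rho)$ isometric either to the open ball of radius $\rho$ about the apex of the Euclidean cone of total angle $\theta_p$ (then $p$ is an interior point) or to the open ball of radius $\rho$ about the apex of the Euclidean sector of angle $\theta_p$ (then $p$ is a boundary point). This holds for instance if $D$ is a topological disk obtained from finitely many Euclidean triangles by gluing edges isometrically, with the resulting length metric. An interior point is \emph{non-singular} if $\theta_p=2\pi$, a boundary point is \emph{non-singular} if $\theta_p=\pi$, and all other points (necessarily finitely many) are \emph{singular}. For $q\in D$ let $\mathbb U_q$ be the set of directions at $q$: it is the circle $\mathbb R/\theta_q\mathbb Z$ if $q$ is an interior point, and the interval $[0,\theta_q]$ of directions pointing into $D$ or along its boundary if $q$ is a boundary point. It carries Lebesgue measure. The \emph{billiard trajectory} from $q$ in the direction $v\in\mathbb U_q$ is the unit-speed curve in $D$ that starts at $q$ in the direction $v$, is locally a straight line at non-singular interior points, is reflected at non-singular boundary points with angle of reflection equal to angle of incidence (running on along the boundary if it is tangent to it), and ends when it reaches a singular point at a positive time; if it never does, it is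 defined for all times $t\ge 0$. \textbf{Theorem.} Let $D$ be a flat disk and let $q\in D$ be an arbitrary point. For Lebesgue-almost every direction $v\in\mathbb U_q$, the billiard trajectory from $q$ in the direction $v$ exists and its closure contains a singular point of $D$. -/

import Mathlib

open Set Filter Topology MeasureTheory

noncomputable section

/-- Distance, in a Euclidean cone, between two points at distances `r` and `s` from the apex whose
directions make the angle `δ ≥ 0` (law of cosines; for `δ ≥ π` the shortest path runs through the
apex and the value is `r + s`). -/
def coneDist (r s δ : ℝ) : ℝ :=
  Real.sqrt (r ^ 2 + s ^ 2 - 2 * r * s * Real.cos (min δ Real.pi))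

/-- `e` describes the open ball of radius `ρ` about `p` isometrically in polar coordinates
`(r, φ)`, with `0 ≤ r < ρ` and `φ ∈ A`, the angle between two directions being `ang φ ψ`. -/
structure IsPolarChart {D : Type*} [MetricSpace D] (A : Set ℝ) (ang : ℝ → ℝ → ℝ)
    (p : D) (ρ : ℝ) (e : ℝ → ℝ → D) : Prop where
  radius_pos : 0 < ρ
  center : ∀ φ ∈ A, e 0 φ = p
  image_eq : (fun x : ℝ × ℝ => e x.1 x.2) '' (Ico 0 ρ ×ˢ A) = Metric.ball p ρ
  dist_eq : ∀ r ∈ Ico 0 ρ, ∀ s ∈ Ico 0 ρ, ∀ φ ∈ A, ∀ ψ ∈ A,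
    dist (e r φ) (e s ψ) = coneDist r s (ang φ ψ)

/-- The open ball of radius `ρ` about `p` is isometric to the ball of radius `ρ` about the apex of
the Euclidean cone of total angle `θ`; directions at `p` are the elements of `ℝ / θℤ`, whose
quotient norm is the angle. So `p` is an interior point of angle `θ`. -/
def IsConeChart {D : Type*} [MetricSpace D] (p : D) (θ ρ : ℝ) (e : ℝ → ℝ → D) : Prop :=
  0 < θ ∧ IsPolarChart univ (fun φ ψ => ‖((φ - ψ : ℝ) : AddCircle θ)‖) p ρ e

/-- The open ball of radius `ρ` about `p` is isometric to the ball of radius `ρ` about the apex of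
the Euclidean sector of angle `θ`; directions at `p` are the elements of `[0, θ]`. So `p` is a
boundary point of angle `θ`, and the directions `0` and `θ` are those of the boundary. -/
def IsSectorChart {D : Type*} [MetricSpace D] (p : D) (θ ρ : ℝ) (e : ℝ → ℝ → D) : Prop :=
  0 < θ ∧ IsPolarChart (Icc 0 θ) (fun φ ψ => |φ - ψ|) p ρ e

/-- A flat disk: a topological closed disk with a flat metric, i.e. one for which every point has a
neighbourhood isometric to a neighbourhood of the apex of a Euclidean cone (interior points) or of a
Euclidean sector (boundary points). -/
structure IsFlatDisk (D : Type*) [MetricSpace D] : Prop where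
  homeomorph_disk : Nonempty (D ≃ₜ Metric.closedBall (0 : ℂ) 1)
  flat : ∀ p : D, ∃ (θ ρ : ℝ) (e : ℝ → ℝ → D), IsConeChart p θ ρ e ∨ IsSectorChart p θ ρ e

/-- A singular point: neither an interior point of angle `2π` nor a boundary point of angle `π`. -/
def IsSingularPoint {D : Type*} [MetricSpace D] (p : D) : Prop :=
  ¬ ∃ (ρ : ℝ) (e : ℝ → ℝ → D), IsConeChart p (2 * Real.pi) ρ e ∨ IsSectorChart p Real.pi ρ e

/-- At time `t` the curve `γ` is at a non-singular point and moves there as a billiard ball with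
unit speed: straight on if that point is an interior point, and according to the law of reflection
(arriving from the direction `π - α`, leaving in the direction `α`) if it is a boundary point. -/
def IsBilliardMotionAt {D : Type*} [MetricSpace D] (γ : ℝ → D) (t : ℝ) : Prop :=
  (∃ (ρ : ℝ) (e : ℝ → ℝ → D) (α : ℝ), IsConeChart (γ t) (2 * Real.pi) ρ e ∧
    ∀ᶠ s in 𝓝[≥] (0 : ℝ), γ (t + s) = e s α ∧ γ (t - s) = e s (α + Real.pi)) ∨
  (∃ (ρ : ℝ) (e : ℝ → ℝ → D) (α : ℝ), IsSectorChart (γ t) Real.pi ρ e ∧ α ∈ Icc 0 Real.pi ∧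
    ∀ᶠ s in 𝓝[≥] (0 : ℝ), γ (t + s) = e s α ∧ γ (t - s) = e s (Real.pi - α))

/-- `γ`, considered for the times `0 ≤ t ≤ T` (`t` real, `T` possibly `∞`), is the billiard
trajectory that leaves the centre of the polar chart `e` in the direction `φ`. It goes on for all
times unless it reaches a singular point at a positive time; it ends at the first such time `T`. -/
structure IsBilliardTrajectory {D : Type*} [MetricSpace D] (e : ℝ → ℝ → D) (φ : ℝ)
    (γ : ℝ → D) (T : EReal) : Prop where
  pos : 0 < T
  start : ∀ᶠ s in 𝓝[≥] (0 : ℝ), γ s = e s φ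
  motion : ∀ t : ℝ, 0 < t → (t : EReal) < T → IsBilliardMotionAt γ t
  singular_end : ∀ τ : ℝ, (τ : EReal) = T →
    IsSingularPoint (γ τ) ∧ Tendsto γ (𝓝[<] τ) (𝓝 (γ τ))

/-- The set of points visited by `γ` at the times `0 ≤ t ≤ T`. -/
def trajectoryRange {D : Type*} (γ : ℝ → D) (T : EReal) : Set D :=
  γ '' {t : ℝ | 0 ≤ t ∧ (t : EReal) ≤ T}

end

/-! Fix `ε > 0` and let `S` be the set of interior directions at `q` whose trajectories stay at
distance at least `ε` from every singular point. Each such `S` is a null set because it is porous at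
each of its points (`volume_eq_zero_of_porous`, from Lebesgue density); a trajectory with no
singular point in its closure has its direction in `S` for some `ε = 1 / (n + 1)`.

Porosity at `φ` rests on two facts. (1) There is `C > 0` such that at arbitrarily small scales `α`
some direction `w` with `|w - φ| < α` runs into a singular point by the time `C / α`. Otherwise, for
every `C`, some sector of half-angle `α` about `φ` is swept out without obstruction up to the time
`C / α`, and it contains an immersed flat disk of radius `C / 8`
(`exists_hasFlatBall_of_lt_lifetime`). By compactness and connectedness, flat disks of all radii
exclude singular points altogether (`IsFlatDisk.not_isSingularPoint_of_hasFlatBall`). But a singular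
point always exists (`IsFlatDisk.exists_isSingularPoint`): without one, the simply connected `D`
would have a developing map `g` to the plane, locally isometric up to the boundary, and `‖g‖` could
not attain its maximum. (2) If the direction `w` has lifetime at most `ℓ`, every `ψ ∈ S` satisfies
`ε ≤ ℓ * |ψ - w|` (`le_mul_abs_sub_of_lifetime_le`): between `w` and `ψ` take the direction of least
lifetime; up to its end at a singular point, the sector between it and `ψ` is flat, so the two
trajectories differ by at most time times angle. With `ℓ = C / α`, the set `S` misses a gap of
radius `(ε / C) * α` about `w`.

Reflections are removed by unfolding: near a regular boundary point `D` is the plane folded along a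
line, and a billiard path is the fold of a straight line. Thus interior and boundary points are
treated together through maps `f : ℂ → D` that are locally folded charts (`FlatAt`), and
trajectories are images of lines (`FlatMotionAt`). -/

/-! ### Local models: the plane and the folded plane -/

/-- The folding of the plane along the real axis onto the closed upper half plane. -/
def fold (w : ℂ) : ℂ := ⟨w.re, |w.im|⟩

@[simp] lemma fold_re (w : ℂ) : (fold w).re = w.re := rfl
@[simp] lemma fold_im (w : ℂ) : (fold w).im = |w.im| := rfl

lemma norm_eq_sqrt_re_im (w : ℂ) : ‖w‖ = Real.sqrt (w.re ^ 2 + w.im ^ 2) := by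
  rw [Complex.norm_eq_sqrt_sq_add_sq]

lemma norm_le_norm_of_abs_re_im {a b : ℂ} (h1 : |a.re| ≤ |b.re|) (h2 : |a.im| ≤ |b.im|) :
    ‖a‖ ≤ ‖b‖ := by
  rw [norm_eq_sqrt_re_im, norm_eq_sqrt_re_im]
  exact Real.sqrt_le_sqrt (add_le_add (sq_le_sq.2 h1) (sq_le_sq.2 h2))

lemma norm_eq_norm_of_abs_re_im {a b : ℂ} (h1 : |a.re| = |b.re|) (h2 : |a.im| = |b.im|) :
    ‖a‖ = ‖b‖ :=
  le_antisymm (norm_le_norm_of_abs_re_im h1.le h2.le) (norm_le_norm_of_abs_re_im h1.ge h2.ge)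

lemma norm_fold (w : ℂ) : ‖fold w‖ = ‖w‖ :=
  norm_eq_norm_of_abs_re_im (by simp) (by simp)

lemma norm_fold_sub_le (a b : ℂ) : ‖fold a - fold b‖ ≤ ‖a - b‖ :=
  norm_le_norm_of_abs_re_im (by simp) (by simpa using abs_abs_sub_abs_le_abs_sub _ _)

lemma fold_fold (w : ℂ) : fold (fold w) = fold w := by
  apply Complex.ext <;> simp

lemma fold_eq_self {w : ℂ} (h : 0 ≤ w.im) : fold w = w := by
  apply Complex.ext <;> simp [abs_of_nonneg h]

lemma fold_conj (w : ℂ) : fold (starRingEnd ℂ w) = fold w := by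
  apply Complex.ext <;> simp

lemma fold_eq_or (w : ℂ) : fold w = w ∨ fold w = starRingEnd ℂ w := by
  rcases le_total 0 w.im with h | h
  · exact Or.inl (fold_eq_self h)
  · right; apply Complex.ext <;> simp [abs_of_nonpos h]

/-- The two local models of a nonsingular point, as retractions of the plane: the whole plane, and
the half plane onto which the plane is folded. -/
def IsModel (κ : ℂ → ℂ) : Prop := κ = id ∨ κ = fold

namespace IsModel

variable {κ : ℂ → ℂ}

lemma norm_map (h : IsModel κ) (w : ℂ) : ‖κ w‖ = ‖w‖ := by
  rcases h with rfl | rfl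
  · rfl
  · exact norm_fold w

lemma map_zero (h : IsModel κ) : κ 0 = 0 := by
  rw [← norm_eq_zero, h.norm_map, norm_zero]

lemma norm_sub_le (h : IsModel κ) (a b : ℂ) : ‖κ a - κ b‖ ≤ ‖a - b‖ := by
  rcases h with rfl | rfl
  · rfl
  · exact norm_fold_sub_le a b

lemma idem (h : IsModel κ) (w : ℂ) : κ (κ w) = κ w := by
  rcases h with rfl | rfl
  · rfl
  · exact fold_fold w

lemma eq_self (h : IsModel κ) {w : ℂ} (hw : 0 ≤ w.im) : κ w = w := by
  rcases h with rfl | rfl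
  · rfl
  · exact fold_eq_self hw

/-- The model identifies only a point and its mirror image, a relation invariant under real scaling.
Hence two lines through `0` that meet in the quotient at one time `s ≠ 0` coincide there at all
times, which is the source of uniqueness of billiard motion. -/
lemma smul_eq_smul (h : IsModel κ) {a b : ℂ} {s : ℝ} (hs : s ≠ 0) (hab : κ (s * a) = κ (s * b))
    (t : ℝ) : κ (t * a) = κ (t * b) := by
  rcases h with rfl | rfl
  · have hs' : (s : ℂ) ≠ 0 := by exact_mod_cast hs
    rw [id, id, mul_right_inj' hs'] at hab
    rw [hab]
  · have h1 := congrArg Complex.re hab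
    have h2 := congrArg Complex.im hab
    simp [abs_mul, hs] at h1 h2
    apply Complex.ext <;> simp [abs_mul, h1, h2]

end IsModel

/-- A map on the plane which preserves distances on a set containing a right-angled corner at the
fixed point `0` is there a linear isometry. -/
lemma exists_linearIsometryEquiv_eqOn {k : ℂ → ℂ} {Q : Set ℂ} {s : ℝ} (hs : 0 < s)
    (h0 : (0 : ℂ) ∈ Q) (h1 : (s : ℂ) ∈ Q) (hI : s * Complex.I ∈ Q) (hk0 : k 0 = 0)
    (hk : ∀ a ∈ Q, ∀ b ∈ Q, ‖k a - k b‖ = ‖a - b‖) :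
    ∃ L : ℂ ≃ₗᵢ[ℝ] ℂ, ∀ a ∈ Q, k a = L a := by
  have hn : ∀ a ∈ Q, ‖k a‖ = ‖a‖ := fun a ha => by simpa [hk0] using hk a ha 0 h0
  have hin : ∀ a ∈ Q, ∀ b ∈ Q, inner ℝ (k a) (k b) = inner ℝ a b := by
    intro a ha b hb
    have e1 := norm_sub_sq_real (k a) (k b)
    have e2 := norm_sub_sq_real a b
    rw [hk a ha b hb, hn a ha, hn b hb] at e1
    linarith
  have hin' : ∀ a ∈ Q, ∀ b ∈ Q, (k a).re * (k b).re + (k a).im * (k b).im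
      = a.re * b.re + a.im * b.im := by
    intro a ha b hb
    have := hin a ha b hb
    simp only [Complex.inner, Complex.mul_re, Complex.conj_re, Complex.conj_im] at this
    linarith
  set u := k s / s with hu
  have hsC : (s : ℂ) ≠ 0 := by exact_mod_cast hs.ne'
  have hks : k s = s * u := by rw [hu]; field_simp
  have hun : ‖u‖ = 1 := by
    have := hn _ h1
    rw [hks, norm_mul] at this
    have h2 : ‖(s : ℂ)‖ ≠ 0 := norm_ne_zero_iff.2 hsC
    field_simp at this
    linarith
  have hun2 : u.re ^ 2 + u.im ^ 2 = 1 := by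
    have := Complex.sq_norm u
    rw [hun, Complex.normSq_apply] at this
    linarith
  -- coordinates of `k a` with respect to `u`
  have hre : ∀ a ∈ Q, (k a).re * u.re + (k a).im * u.im = a.re := by
    intro a ha
    have := hin' a ha _ h1
    rw [hks] at this
    simp at this
    have h3 : s * ((k a).re * u.re + (k a).im * u.im) = s * a.re := by linarith
    exact mul_left_cancel₀ hs.ne' h3
  -- `m` is the component of `k (s * I)` orthogonal to `u`; whether `m = s` or `m = -s` decides
  -- between a rotation and a reflection.
  set m := (k (s * Complex.I)).im * u.re - (k (s * Complex.I)).re * u.im with hm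
  have hI0 := hre _ hI
  simp at hI0
  have hkre : (k (s * Complex.I)).re = - m * u.im := by
    rw [hm]; linear_combination (-(k (s * Complex.I)).re) * hun2 + u.re * hI0
  have hkim : (k (s * Complex.I)).im = m * u.re := by
    rw [hm]; linear_combination (-(k (s * Complex.I)).im) * hun2 + u.im * hI0
  have hm2 : m ^ 2 = s ^ 2 := by
    have := hin' _ hI _ hI
    rw [hkre, hkim] at this
    simp at this
    linear_combination this - m ^ 2 * hun2
  have him : ∀ a ∈ Q, m * ((k a).im * u.re - (k a).re * u.im) = s * a.im := by
    intro a ha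
    have := hin' a ha _ hI
    rw [hkre, hkim] at this
    simp at this
    linarith
  obtain ⟨c, hc⟩ : ∃ c : Circle, (c : ℂ) = u := ⟨⟨u, mem_sphere_zero_iff_norm.2 hun⟩, rfl⟩
  rcases sq_eq_sq_iff_eq_or_eq_neg.1 hm2 with h | h
  · refine ⟨rotation c, fun a ha => ?_⟩
    have h2 : (k a).im * u.re - (k a).re * u.im = a.im := by
      have := him a ha; rw [h] at this; exact mul_left_cancel₀ hs.ne' this
    have h1 := hre a ha
    rw [rotation_apply, hc]
    apply Complex.ext
    · rw [Complex.mul_re]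
      linear_combination (-(k a).re) * hun2 + u.re * h1 - u.im * h2
    · rw [Complex.mul_im]
      linear_combination (-(k a).im) * hun2 + u.im * h1 + u.re * h2
  · refine ⟨Complex.conjLIE.trans (rotation c), fun a ha => ?_⟩
    have h2 : (k a).im * u.re - (k a).re * u.im = - a.im := by
      have := him a ha; rw [h] at this
      exact mul_left_cancel₀ hs.ne' (by linarith)
    have h1 := hre a ha
    rw [LinearIsometryEquiv.trans_apply, rotation_apply, hc, Complex.conjLIE_apply]
    apply Complex.ext
    · rw [Complex.mul_re, Complex.conj_re, Complex.conj_im]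
      linear_combination (-(k a).re) * hun2 + u.re * h1 - u.im * h2
    · rw [Complex.mul_im, Complex.conj_re, Complex.conj_im]
      linear_combination (-(k a).im) * hun2 + u.im * h1 + u.re * h2

/-! ### Folded charts and flat maps -/

/-- `g` maps the disk of radius `ρ` about the origin onto the ball of radius `ρ` about `g 0`; it is
the composition of the retraction `κ` onto the local model with an isometry. -/
structure IsFoldedChart {D : Type*} [MetricSpace D] (κ : ℂ → ℂ) (ρ : ℝ) (g : ℂ → D) : Prop where
  model : IsModel κ
  pos : 0 < ρ
  dist_eq : ∀ w w', ‖w‖ < ρ → ‖w'‖ < ρ → dist (g w) (g w') = ‖κ w - κ w'‖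
  surj : ∀ y, dist y (g 0) < ρ → ∃ w, ‖w‖ < ρ ∧ g w = y

/-- `f` is, near `z` and up to a motion of the plane, a folded chart. -/
def FlatAt {D : Type*} [MetricSpace D] (f : ℂ → D) (z : ℂ) : Prop :=
  ∃ (L : ℂ ≃ₗᵢ[ℝ] ℂ) (κ : ℂ → ℂ) (ρ : ℝ), IsFoldedChart κ ρ fun w => f (z + L w)

namespace IsFoldedChart

variable {D : Type*} [MetricSpace D] {κ κ' : ℂ → ℂ} {ρ : ℝ} {g g' : ℂ → D}

lemma dist_zero (h : IsFoldedChart κ ρ g) {w : ℂ} (hw : ‖w‖ < ρ) : dist (g w) (g 0) = ‖w‖ := by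
  rw [h.dist_eq w 0 hw (by simpa using h.pos), h.model.map_zero, sub_zero, h.model.norm_map]

lemma mono (h : IsFoldedChart κ ρ g) {r : ℝ} (hr : 0 < r) (hrρ : r ≤ ρ) :
    IsFoldedChart κ r g where
  model := h.model
  pos := hr
  dist_eq w w' hw hw' := h.dist_eq w w' (hw.trans_le hrρ) (hw'.trans_le hrρ)
  surj y hy := by
    obtain ⟨w, hw, rfl⟩ := h.surj y (hy.trans_le hrρ)
    exact ⟨w, by rwa [h.dist_zero hw] at hy, rfl⟩

lemma congr (h : IsFoldedChart κ ρ g) (hgg : ∀ w, ‖w‖ < ρ → g' w = g w) :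
    IsFoldedChart κ ρ g' where
  model := h.model
  pos := h.pos
  dist_eq w w' hw hw' := by rw [hgg w hw, hgg w' hw', h.dist_eq w w' hw hw']
  surj y hy := by
    rw [hgg 0 (by simpa using h.pos)] at hy
    obtain ⟨w, hw, rfl⟩ := h.surj y hy
    exact ⟨w, hw, hgg w hw⟩

lemma apply_eq_iff (h : IsFoldedChart κ ρ g) {w w' : ℂ} (hw : ‖w‖ < ρ) (hw' : ‖w'‖ < ρ) :
    g w = g w' ↔ κ w = κ w' := by
  rw [← dist_eq_zero, h.dist_eq w w' hw hw', norm_sub_eq_zero_iff]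

lemma apply_model (h : IsFoldedChart κ ρ g) {w : ℂ} (hw : ‖w‖ < ρ) : g (κ w) = g w := by
  rw [h.apply_eq_iff (by rwa [h.model.norm_map]) hw, h.model.idem]

lemma flatAt_zero (h : IsFoldedChart κ ρ g) : FlatAt g 0 :=
  ⟨LinearIsometryEquiv.refl ℝ ℂ, κ, ρ, by simpa using h⟩

/-- Two folded charts at the same point differ by a linear isometry. -/
lemma exists_eq_comp (h : IsFoldedChart κ ρ g) (h' : IsFoldedChart κ' ρ g') (h0 : g 0 = g' 0) :
    ∃ M : ℂ ≃ₗᵢ[ℝ] ℂ, ∀ w, ‖w‖ < ρ → g w = g' (M w) := by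
  have hρ := h.pos
  have hex : ∀ w, ∃ w', ‖w‖ < ρ → ‖w'‖ < ρ ∧ g' w' = g w := by
    intro w
    by_cases hw : ‖w‖ < ρ
    · obtain ⟨w', hw'⟩ := h'.surj (g w) (by rwa [← h0, h.dist_zero hw])
      exact ⟨w', fun _ => hw'⟩
    · exact ⟨0, fun h => absurd h hw⟩
  choose k hk using hex
  -- On the fixed points of `κ` the chart `g` is an isometric embedding, and they contain the corner
  -- `0`, `ρ / 2`, `(ρ / 2) * I` in both models.
  set Q : Set ℂ := {w | ‖w‖ < ρ ∧ κ w = w} with hQ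
  have hQim : ∀ w : ℂ, ‖w‖ < ρ → 0 ≤ w.im → w ∈ Q := fun w hw hi => ⟨hw, h.model.eq_self hi⟩
  have hn : ∀ w, ‖w‖ < ρ → ‖k w‖ = ‖w‖ := by
    intro w hw
    rw [← h'.dist_zero (hk w hw).1, (hk w hw).2, ← h0, h.dist_zero hw]
  have hs : ‖((ρ / 2 : ℝ) : ℂ)‖ < ρ := by
    rw [Complex.norm_real, Real.norm_of_nonneg (by positivity)]; linarith
  have hsI : ‖((ρ / 2 : ℝ) : ℂ) * Complex.I‖ < ρ := by
    rw [norm_mul, Complex.norm_I, mul_one]; exact hs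
  obtain ⟨L, hL⟩ := exists_linearIsometryEquiv_eqOn (k := fun w => κ' (k w)) (Q := Q)
    (s := ρ / 2) (by positivity) (hQim 0 (by simpa using hρ) (by simp))
    (hQim _ hs (by simp)) (hQim _ hsI (by simp; positivity))
    (by
      have : ‖k 0‖ = 0 := by simpa using hn 0 (by simpa using hρ)
      rw [norm_eq_zero.1 this, h'.model.map_zero])
    (by
      rintro a ⟨ha, hka⟩ b ⟨hb, hkb⟩
      rw [← h'.dist_eq _ _ (hk a ha).1 (hk b hb).1, (hk a ha).2, (hk b hb).2,
        h.dist_eq a b ha hb, hka, hkb])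
  have hmem : ∀ w, ‖w‖ < ρ → κ w ∈ Q := fun w hw =>
    ⟨by rwa [h.model.norm_map], h.model.idem w⟩
  have key : ∀ w, ‖w‖ < ρ → g w = g' (L (κ w)) := by
    intro w hw
    have h1 := hk (κ w) (hmem w hw).1
    rw [← h.apply_model hw, ← h1.2, ← hL _ (hmem w hw), h'.apply_model h1.1]
  have hfix : ∀ w ∈ Q, κ' (L w) = L w := fun w hw => by
    rw [← hL w hw, h'.model.idem]
  refine ⟨L, fun w hw => ?_⟩
  rw [key w hw]
  have hLn : ∀ x, ‖x‖ < ρ → ‖L x‖ < ρ := fun x hx => by rwa [L.norm_map]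
  rcases h.model with rfl | hκ
  · rfl
  rcases h'.model with hκ' | hκ'
  -- A half disk cannot fill a disk: the reflected point `L (-x)` would have to come from the upper
  -- half plane.
  · exfalso
    set x : ℂ := ((ρ / 2 : ℝ) : ℂ) * Complex.I with hx
    have hxn : ‖L (-x)‖ < ρ := hLn _ (by rwa [norm_neg])
    obtain ⟨y, hy, hgy⟩ := h.surj (g' (L (-x))) (by rw [h0, h'.dist_zero hxn]; exact hxn)
    rw [key y hy, h'.apply_eq_iff (hLn _ (hmem y hy).1) hxn, hκ'] at hgy
    have := congrArg Complex.im (L.injective hgy)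
    rw [hκ] at this
    simp [hx] at this
    have h2 := abs_nonneg y.im
    linarith
  · rw [h'.apply_eq_iff (hLn _ (hmem w hw).1) (hLn _ hw), hκ, hκ']
    obtain ⟨a, ha⟩ := linear_isometry_complex L
    have hL1 : L ((ρ / 2 : ℝ) : ℂ) = a * ((ρ / 2 : ℝ) : ℂ) := by
      rcases ha with ha | ha <;> simp [ha, rotation_apply, -Complex.ofReal_div]
    have hp := congrArg Complex.im (hfix _ (hQim _ hs (by simp)))
    have hm := congrArg Complex.im (hfix _ (hQim (-((ρ / 2 : ℝ) : ℂ)) (by rwa [norm_neg])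
      (by simp)))
    rw [map_neg, hL1, hκ'] at hm
    rw [hL1, hκ'] at hp
    -- `L` sends both of `±ρ / 2` into the closed upper half plane, so it preserves the real axis
    -- and commutes with the folding.
    have haim : (a : ℂ).im = 0 := by
      simp [-Complex.ofReal_div] at hp hm
      have h1 : 0 ≤ (a : ℂ).im * (ρ / 2) := hp ▸ by positivity
      have h2 : 0 ≤ -((a : ℂ).im * (ρ / 2)) := hm ▸ by positivity
      nlinarith
    have hconj : starRingEnd ℂ (a : ℂ) = a := by
      apply Complex.ext <;> simp [haim]
    rcases fold_eq_or w with h1 | h1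
    · rw [h1]
    · rw [h1]
      have : L (starRingEnd ℂ w) = starRingEnd ℂ (L w) := by
        rcases ha with ha | ha <;> simp [ha, rotation_apply, hconj]
      rw [this, fold_conj]

/-- A folded chart is flat at every point of its disk. -/
lemma flatAt (h : IsFoldedChart κ ρ g) {w : ℂ} (hw : ‖w‖ < ρ) : FlatAt g w := by
  have hsub : ∀ {x : ℂ}, ‖x‖ < ρ - ‖w‖ → ‖w + x‖ < ρ := fun {x} hx => by
    have := norm_add_le w x; linarith
  have hball : ∀ y, dist y (g w) < ρ - ‖w‖ → dist y (g 0) < ρ := fun y hy => by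
    have := dist_triangle y (g w) (g 0); rw [h.dist_zero hw] at this; linarith
  have hpos : 0 < ρ - ‖w‖ := by linarith
  refine ⟨LinearIsometryEquiv.refl ℝ ℂ, ?_⟩
  simp only [LinearIsometryEquiv.coe_refl, id]
  rcases h.model with rfl | rfl
  · refine ⟨id, ρ - ‖w‖, Or.inl rfl, hpos, fun x x' hx hx' => ?_, fun y hy => ?_⟩
    · rw [h.dist_eq _ _ (hsub hx) (hsub hx')]; simp
    · rw [add_zero] at hy
      obtain ⟨w1, hw1, rfl⟩ := h.surj y (hball y hy)
      refine ⟨w1 - w, ?_, by simp⟩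
      rwa [h.dist_eq _ _ hw1 hw] at hy
  · by_cases him : w.im = 0
    · have hadd : ∀ x, fold (w + x) = w + fold x := by
        intro x; apply Complex.ext <;> simp [him]
      refine ⟨fold, ρ - ‖w‖, Or.inr rfl, hpos, fun x x' hx hx' => ?_, fun y hy => ?_⟩
      · rw [h.dist_eq _ _ (hsub hx) (hsub hx'), hadd, hadd]; simp
      · rw [add_zero] at hy
        obtain ⟨w1, hw1, rfl⟩ := h.surj y (hball y hy)
        refine ⟨fold w1 - w, ?_, by simpa using h.apply_model hw1⟩
        rwa [h.dist_eq _ _ hw1 hw, fold_eq_self him.ge] at hy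
    -- Within distance `|w.im|` the folding line is not crossed, so the unfolded model applies at
    -- `w`.
    · have hmin : 0 < min (ρ - ‖w‖) |w.im| := lt_min hpos (abs_pos.2 him)
      refine ⟨id, min (ρ - ‖w‖) |w.im|, Or.inl rfl, hmin, fun x x' hx hx' => ?_, fun y hy => ?_⟩
      · rw [h.dist_eq _ _ (hsub (hx.trans_le (min_le_left _ _)))
          (hsub (hx'.trans_le (min_le_left _ _)))]
        have hxi := (Complex.abs_im_le_norm x).trans_lt (hx.trans_le (min_le_right _ _))
        have hxi' := (Complex.abs_im_le_norm x').trans_lt (hx'.trans_le (min_le_right _ _))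
        apply norm_eq_norm_of_abs_re_im
        · simp
        · simp only [Complex.sub_im, fold_im, Complex.add_im, id]
          rcases lt_or_gt_of_ne him with hi | hi
          · rw [abs_of_neg hi] at hxi hxi'
            rw [abs_of_neg (show w.im + x.im < 0 by linarith [le_abs_self x.im]),
              abs_of_neg (show w.im + x'.im < 0 by linarith [le_abs_self x'.im]),
              abs_sub_comm x.im]
            ring_nf
          · rw [abs_of_pos hi] at hxi hxi'
            rw [abs_of_pos (show 0 < w.im + x.im by linarith [neg_abs_le x.im]),
              abs_of_pos (show 0 < w.im + x'.im by linarith [neg_abs_le x'.im])]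
            ring_nf
      · rw [add_zero] at hy
        obtain ⟨w1, hw1, rfl⟩ := h.surj y (hball y (hy.trans_le (min_le_left _ _)))
        rw [h.dist_eq _ _ hw1 hw] at hy
        rcases lt_or_gt_of_ne him with hi | hi
        -- Here `w` lies below the folding line, so the preimage close to it is the mirror image of
        -- `fold w1`.
        · have hw' : w = starRingEnd ℂ (fold w) := by
            apply Complex.ext <;> simp [abs_of_neg hi]
          have hn : ‖starRingEnd ℂ (fold w1)‖ < ρ := by
            rwa [RCLike.norm_conj, norm_fold]
          refine ⟨starRingEnd ℂ (fold w1) - w, ?_, ?_⟩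
          · rwa [hw', ← map_sub, RCLike.norm_conj, ← hw']
          · rw [add_sub_cancel, h.apply_eq_iff hn hw1, fold_conj, fold_fold]
        · refine ⟨fold w1 - w, ?_, by simpa using h.apply_model hw1⟩
          rwa [fold_eq_self hi.le] at hy

end IsFoldedChart

namespace FlatAt

variable {D : Type*} [MetricSpace D] {f f' : ℂ → D} {z z' : ℂ}

lemma congr (h : FlatAt f z) (hff : f' =ᶠ[𝓝 z] f) : FlatAt f' z := by
  obtain ⟨L, κ, ρ, hc⟩ := h
  obtain ⟨r, hr, hball⟩ := Metric.eventually_nhds_iff.1 hff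
  refine ⟨L, κ, min ρ r, (hc.mono (lt_min hc.pos hr) (min_le_left _ _)).congr fun w hw => ?_⟩
  apply hball
  simpa using hw.trans_le (min_le_right _ _)

/-- Flatness is preserved by motions of the plane. -/
lemma comp_motion {c d : ℂ} {M : ℂ ≃ₗᵢ[ℝ] ℂ} (h : FlatAt f (c + M (z - d))) :
    FlatAt (fun x => f (c + M (x - d))) z := by
  obtain ⟨L, κ, ρ, hc⟩ := h
  refine ⟨L.trans M.symm, κ, ρ, ?_⟩
  convert hc using 3 with w
  simp [add_sub_right_comm, map_add, add_assoc]

lemma comp_add {c : ℂ} (h : FlatAt f (c + z)) : FlatAt (fun x => f (c + x)) z := by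
  have h' : FlatAt f (c + (LinearIsometryEquiv.refl ℝ ℂ) (z - 0)) := by simpa using h
  simpa using h'.comp_motion

lemma exists_eq_comp (h : FlatAt f z) (h' : FlatAt f' z') (h0 : f z = f' z') :
    ∃ M : ℂ ≃ₗᵢ[ℝ] ℂ, ∀ᶠ w in 𝓝 (0 : ℂ), f (z + w) = f' (z' + M w) := by
  obtain ⟨L, κ, ρ, hc⟩ := h
  obtain ⟨L', κ', ρ', hc'⟩ := h'
  have hm : 0 < min ρ ρ' := lt_min hc.pos hc'.pos
  obtain ⟨M, hM⟩ := (hc.mono hm (min_le_left _ _)).exists_eq_comp (hc'.mono hm (min_le_right _ _))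
    (by simpa using h0)
  refine ⟨(L.symm.trans M).trans L', ?_⟩
  filter_upwards [Metric.ball_mem_nhds (0 : ℂ) hm] with w hw
  have := hM (L.symm w) (by simpa using hw)
  simpa using this

/-- Flat maps which agree at one point of a line near a common value agree on that line. -/
lemma line_unique (h : FlatAt f z) (h' : FlatAt f' z') (h0 : f z = f' z') (v v' : ℂ) :
    ∃ δ > 0, ∀ s : ℝ, s ≠ 0 → |s| < δ → f (z + s * v) = f' (z' + s * v') →
      ∀ t : ℝ, |t| < δ → f (z + t * v) = f' (z' + t * v') := by
  obtain ⟨M, hM⟩ := h.exists_eq_comp h' h0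
  obtain ⟨L', κ', ρ', hc'⟩ := h'
  have ev : ∀ᶠ t : ℝ in 𝓝 0, f (z + t * v) = f' (z' + M (t * v)) ∧
      ‖L'.symm (M (t * v))‖ < ρ' ∧ ‖L'.symm (t * v')‖ < ρ' := by
    have c1 : Tendsto (fun t : ℝ => (t : ℂ) * v) (𝓝 0) (𝓝 0) := by
      have : Continuous fun t : ℝ => (t : ℂ) * v := by fun_prop
      simpa using this.tendsto 0
    have c2 : Tendsto (fun t : ℝ => ‖L'.symm (M (t * v))‖) (𝓝 0) (𝓝 0) := by
      simpa using c1.norm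
    have c3 : Tendsto (fun t : ℝ => ‖L'.symm (t * v')‖) (𝓝 0) (𝓝 0) := by
      have : Continuous fun t : ℝ => ‖L'.symm (t * v')‖ := by fun_prop
      simpa using this.tendsto 0
    exact (c1.eventually hM).and
      ((c2.eventually (gt_mem_nhds hc'.pos)).and (c3.eventually (gt_mem_nhds hc'.pos)))
  obtain ⟨δ, hδ, hball⟩ := Metric.eventually_nhds_iff.1 ev
  refine ⟨δ, hδ, fun s hs hsδ hs' t ht => ?_⟩
  have hmul : ∀ (N : ℂ ≃ₗᵢ[ℝ] ℂ) (t : ℝ) (x : ℂ), N (t * x) = t * N x := fun N t x => by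
    rw [← Complex.real_smul, map_smul, Complex.real_smul]
  have key : ∀ t : ℝ, |t| < δ → (f (z + t * v) = f' (z' + t * v') ↔
      κ' (t * L'.symm (M v)) = κ' (t * L'.symm v')) := by
    intro t ht
    obtain ⟨e1, e2, e3⟩ := hball (y := t) (by simpa using ht)
    have := hc'.apply_eq_iff e2 e3
    simp only [LinearIsometryEquiv.apply_symm_apply] at this
    rw [e1, this]
    simp only [hmul]
  rw [key t ht]
  exact hc'.model.smul_eq_smul hs ((key s hsδ).1 hs') t

lemma exists_lipschitz (h : FlatAt f z) :
    ∃ δ > 0, ∀ x y, ‖x - z‖ < δ → ‖y - z‖ < δ → dist (f x) (f y) ≤ ‖x - y‖ := by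
  obtain ⟨L, κ, ρ, hc⟩ := h
  refine ⟨ρ, hc.pos, fun x y hx hy => ?_⟩
  have := hc.dist_eq (L.symm (x - z)) (L.symm (y - z)) (by rwa [L.symm.norm_map])
    (by rwa [L.symm.norm_map])
  simp only [LinearIsometryEquiv.apply_symm_apply, add_sub_cancel] at this
  rw [this]
  refine (hc.model.norm_sub_le _ _).trans_eq ?_
  rw [← map_sub, LinearIsometryEquiv.norm_map]; simp

lemma continuousAt (h : FlatAt f z) : ContinuousAt f z := by
  obtain ⟨δ, hδ, hl⟩ := h.exists_lipschitz
  rw [Metric.continuousAt_iff]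
  intro ε hε
  refine ⟨min δ ε, lt_min hδ hε, fun x hx => ?_⟩
  rw [dist_eq_norm] at hx
  exact (hl x z (hx.trans_le (min_le_left _ _)) (by simpa using hδ)).trans_lt
    (hx.trans_le (min_le_right _ _))

lemma exists_chart (h : FlatAt f z) :
    ∃ (g : ℂ → D) (κ : ℂ → ℂ) (ρ : ℝ), IsFoldedChart κ ρ g ∧ g 0 = f z := by
  obtain ⟨L, κ, ρ, hc⟩ := h
  exact ⟨_, κ, ρ, hc, by simp⟩

/-- The values of a flat map near a point fill a ball. -/
lemma exists_ball_subset (h : FlatAt f z) {ε : ℝ} (hε : 0 < ε) :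
    ∃ r > 0, ∀ y, dist y (f z) < r → ∃ x, ‖x - z‖ < ε ∧ FlatAt f x ∧ f x = y := by
  obtain ⟨L, κ, ρ, hc⟩ := h
  have hm : 0 < min ρ ε := lt_min hc.pos hε
  refine ⟨min ρ ε, hm, fun y hy => ?_⟩
  obtain ⟨w, hw, rfl⟩ := (hc.mono hm (min_le_left _ _)).surj y (by simpa using hy)
  refine ⟨z + L w, by simpa using hw.trans_le (min_le_right _ _), ?_, rfl⟩
  have h1 := hc.flatAt (hw.trans_le (min_le_left _ _))
  have h3 := (FlatAt.comp_motion (f := fun w => f (z + L w)) (c := 0) (d := z) (M := L.symm)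
    (z := z + L w) (by simpa using h1))
  simpa using h3

end FlatAt

/-! ### Unit vectors and the law of cosines -/

/-- The unit vector with argument `ψ`. -/
noncomputable def unitVec (ψ : ℝ) : ℂ := Complex.exp (ψ * Complex.I)

@[simp] lemma unitVec_re (ψ : ℝ) : (unitVec ψ).re = Real.cos ψ := Complex.exp_ofReal_mul_I_re ψ

@[simp] lemma unitVec_im (ψ : ℝ) : (unitVec ψ).im = Real.sin ψ := Complex.exp_ofReal_mul_I_im ψ

@[simp] lemma norm_unitVec (ψ : ℝ) : ‖unitVec ψ‖ = 1 := Complex.norm_exp_ofReal_mul_I ψ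

lemma unitVec_add (φ ψ : ℝ) : unitVec (φ + ψ) = unitVec φ * unitVec ψ := by
  simp [unitVec, ← Complex.exp_add, add_mul]

lemma unitVec_add_pi (ψ : ℝ) : unitVec (ψ + Real.pi) = -unitVec ψ := by
  apply Complex.ext <;> simp

lemma continuous_unitVec : Continuous unitVec := by unfold unitVec; fun_prop

lemma norm_mul_unitVec_arg (z : ℂ) : ‖z‖ * unitVec z.arg = z := Complex.norm_mul_exp_arg_mul_I z

lemma norm_mul_unitVec {r : ℝ} (hr : 0 ≤ r) (ψ : ℝ) : ‖r * unitVec ψ‖ = r := by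
  simp [abs_of_nonneg hr]

lemma norm_mul_unitVec_sub_sq (r s φ ψ : ℝ) :
    ‖r * unitVec φ - s * unitVec ψ‖ ^ 2 = r ^ 2 + s ^ 2 - 2 * r * s * Real.cos (φ - ψ) := by
  rw [Complex.sq_norm, Complex.normSq_apply, Real.cos_sub]
  simp
  linear_combination r ^ 2 * Real.sin_sq_add_cos_sq φ + s ^ 2 * Real.sin_sq_add_cos_sq ψ

lemma norm_mul_unitVec_sub (r s φ ψ : ℝ) :
    ‖r * unitVec φ - s * unitVec ψ‖ = √(r ^ 2 + s ^ 2 - 2 * r * s * Real.cos (φ - ψ)) := by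
  rw [← norm_mul_unitVec_sub_sq, Real.sqrt_sq (norm_nonneg _)]

lemma norm_mul_unitVec_sub_le {t : ℝ} (ht : 0 ≤ t) (φ ψ : ℝ) :
    ‖t * unitVec φ - t * unitVec ψ‖ ≤ t * |φ - ψ| := by
  refine abs_le_of_sq_le_sq' ?_ (by positivity) |>.2
  rw [norm_mul_unitVec_sub_sq, mul_pow, sq_abs]
  nlinarith [Real.one_sub_sq_div_two_le_cos (x := φ - ψ), sq_nonneg t]

lemma coneDist_of_abs_le {φ ψ : ℝ} (h : |φ - ψ| ≤ Real.pi) (r s : ℝ) :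
    coneDist r s |φ - ψ| = ‖r * unitVec φ - s * unitVec ψ‖ := by
  rw [coneDist, min_eq_left h, Real.cos_abs, norm_mul_unitVec_sub]

lemma coneDist_addCircle_two_pi (r s φ ψ : ℝ) :
    coneDist r s ‖((φ - ψ : ℝ) : AddCircle (2 * Real.pi))‖ = ‖r * unitVec φ - s * unitVec ψ‖ := by
  have hle : ‖((φ - ψ : ℝ) : AddCircle (2 * Real.pi))‖ ≤ Real.pi := by
    have := AddCircle.norm_le_half_period (2 * Real.pi) Real.two_pi_pos.ne'
      (x := ((φ - ψ : ℝ) : AddCircle (2 * Real.pi)))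
    rwa [abs_of_pos Real.two_pi_pos, mul_div_cancel_left₀ _ two_ne_zero] at this
  rw [coneDist, min_eq_left hle, AddCircle.norm_eq, Real.cos_abs, Real.cos_sub_int_mul_two_pi,
    norm_mul_unitVec_sub]

lemma coneDist_zero_right {r : ℝ} (hr : 0 ≤ r) (δ : ℝ) : coneDist r 0 δ = r := by
  simp [coneDist, Real.sqrt_sq hr]

lemma coneDist_self_le {r δ : ℝ} (hr : 0 ≤ r) (hδ : 0 ≤ δ) : coneDist r r δ ≤ r * δ := by
  rw [coneDist]
  refine Real.sqrt_le_iff.2 ⟨by positivity, ?_⟩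
  have h1 := Real.one_sub_sq_div_two_le_cos (x := min δ Real.pi)
  have h2 : (min δ Real.pi) ^ 2 ≤ δ ^ 2 :=
    pow_le_pow_left₀ (le_min hδ Real.pi_pos.le) (min_le_left _ _) 2
  nlinarith [sq_nonneg r]

/-- A point at distance `r` from the apex is at least `r * sin η` away from every ray that makes an
angle at least `η` with its own. Hence points close to it have nearly its direction. -/
lemma mul_sin_le_coneDist {r s δ η : ℝ} (hr : 0 ≤ r) (hs : 0 ≤ s) (hη : 0 ≤ η)
    (hηπ : η ≤ Real.pi) (h : η ≤ δ) : r * Real.sin η ≤ coneDist s r δ := by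
  rw [coneDist]
  refine Real.le_sqrt_of_sq_le ?_
  have h1 : Real.cos (min δ Real.pi) ≤ Real.cos η :=
    Real.cos_le_cos_of_nonneg_of_le_pi hη (min_le_right _ _) (le_min h hηπ)
  have h2 := mul_le_mul_of_nonneg_left h1 (mul_nonneg hs hr)
  nlinarith [sq_nonneg (s - r * Real.cos η), Real.sin_sq_add_cos_sq η, sq_nonneg r]

lemma fold_real_mul {s : ℝ} (hs : 0 ≤ s) (a : ℂ) : fold (s * a) = s * fold a := by
  apply Complex.ext <;> simp [abs_mul, abs_of_nonneg hs]

lemma fold_neg_unitVec {α : ℝ} (h : α ∈ Icc 0 Real.pi) :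
    fold (-unitVec α) = unitVec (Real.pi - α) := by
  apply Complex.ext <;> simp [Real.sin_nonneg_of_mem_Icc h]

lemma fold_unitVec {α : ℝ} (h : α ∈ Icc 0 Real.pi) : fold (unitVec α) = unitVec α :=
  fold_eq_self (by simpa using Real.sin_nonneg_of_mem_Icc h)

lemma norm_mul_unitVec_abs_arg (z : ℂ) : ‖z‖ * unitVec |z.arg| = fold z := by
  have h : |z.arg| ∈ Icc 0 Real.pi := ⟨abs_nonneg _, Complex.abs_arg_le_pi z⟩
  conv_rhs => rw [← norm_mul_unitVec_arg z, fold_real_mul (norm_nonneg z)]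
  rcases abs_choice z.arg with h1 | h1
  · rw [h1] at h ⊢; rw [fold_unitVec h]
  · have : unitVec z.arg = starRingEnd ℂ (unitVec |z.arg|) := by
      rw [h1]; apply Complex.ext <;> simp
    rw [this, fold_conj, fold_unitVec h]

/-! ### Regular points: polar charts and folded charts -/

section Charts

variable {D : Type*} [MetricSpace D] {p : D} {ρ : ℝ} {e : ℝ → ℝ → D}

lemma IsConeChart.dist_eq_norm (h : IsConeChart p (2 * Real.pi) ρ e) {r s : ℝ} (hr : r ∈ Ico 0 ρ)
    (hs : s ∈ Ico 0 ρ) (φ ψ : ℝ) :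
    dist (e r φ) (e s ψ) = ‖r * unitVec φ - s * unitVec ψ‖ := by
  rw [h.2.dist_eq r hr s hs φ trivial ψ trivial, coneDist_addCircle_two_pi]

lemma IsSectorChart.dist_eq_norm (h : IsSectorChart p Real.pi ρ e) {r s φ ψ : ℝ}
    (hr : r ∈ Ico 0 ρ) (hs : s ∈ Ico 0 ρ) (hφ : φ ∈ Icc 0 Real.pi) (hψ : ψ ∈ Icc 0 Real.pi) :
    dist (e r φ) (e s ψ) = ‖r * unitVec φ - s * unitVec ψ‖ := by
  rw [h.2.dist_eq r hr s hs φ hφ ψ hψ, coneDist_of_abs_le]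
  rw [abs_le]; constructor <;> linarith [hφ.1, hφ.2, hψ.1, hψ.2]

lemma IsConeChart.apply_eq (h : IsConeChart p (2 * Real.pi) ρ e) {r : ℝ} (hr : r ∈ Ico 0 ρ)
    (φ : ℝ) : e ‖r * unitVec φ‖ (r * unitVec φ).arg = e r φ := by
  rw [← dist_eq_zero, norm_mul_unitVec hr.1, h.dist_eq_norm hr hr]
  have := norm_mul_unitVec_arg (r * unitVec φ)
  rw [norm_mul_unitVec hr.1] at this
  rw [this, sub_self, norm_zero]

lemma IsConeChart.isFoldedChart (h : IsConeChart p (2 * Real.pi) ρ e) :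
    IsFoldedChart id ρ fun z => e ‖z‖ z.arg where
  model := Or.inl rfl
  pos := h.2.radius_pos
  dist_eq w w' hw hw' := by
    rw [h.dist_eq_norm ⟨norm_nonneg w, hw⟩ ⟨norm_nonneg w', hw'⟩, norm_mul_unitVec_arg,
      norm_mul_unitVec_arg]
    rfl
  surj y hy := by
    have hy' : y ∈ Metric.ball p ρ := by simpa [h.2.center _ trivial] using hy
    rw [← h.2.image_eq] at hy'
    obtain ⟨⟨r, φ⟩, ⟨hr, -⟩, rfl⟩ := hy'
    exact ⟨r * unitVec φ, by rw [norm_mul_unitVec hr.1]; exact hr.2, h.apply_eq hr φ⟩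

lemma IsSectorChart.apply_eq (h : IsSectorChart p Real.pi ρ e) {r φ : ℝ} (hr : r ∈ Ico 0 ρ)
    (hφ : φ ∈ Icc 0 Real.pi) : e ‖r * unitVec φ‖ |(r * unitVec φ).arg| = e r φ := by
  rw [← dist_eq_zero, norm_mul_unitVec hr.1,
    h.dist_eq_norm hr hr ⟨abs_nonneg _, Complex.abs_arg_le_pi _⟩ hφ]
  have := norm_mul_unitVec_abs_arg (r * unitVec φ)
  rw [norm_mul_unitVec hr.1, fold_real_mul hr.1, fold_unitVec hφ] at this
  rw [this, sub_self, norm_zero]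

lemma IsSectorChart.isFoldedChart (h : IsSectorChart p Real.pi ρ e) :
    IsFoldedChart fold ρ fun z => e ‖z‖ |z.arg| where
  model := Or.inr rfl
  pos := h.2.radius_pos
  dist_eq w w' hw hw' := by
    rw [h.dist_eq_norm ⟨norm_nonneg w, hw⟩ ⟨norm_nonneg w', hw'⟩
      ⟨abs_nonneg _, Complex.abs_arg_le_pi _⟩ ⟨abs_nonneg _, Complex.abs_arg_le_pi _⟩,
      norm_mul_unitVec_abs_arg, norm_mul_unitVec_abs_arg]
  surj y hy := by
    have h0 : (0 : ℝ) ∈ Icc 0 Real.pi := ⟨le_rfl, Real.pi_pos.le⟩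
    have hy' : y ∈ Metric.ball p ρ := by simpa [h.2.center _ h0] using hy
    rw [← h.2.image_eq] at hy'
    obtain ⟨⟨r, φ⟩, ⟨hr, hφ⟩, rfl⟩ := hy'
    exact ⟨r * unitVec φ, by rw [norm_mul_unitVec hr.1]; exact hr.2, h.apply_eq hr hφ⟩

lemma IsFoldedChart.isConeChart {g : ℂ → D} (h : IsFoldedChart id ρ g) :
    IsConeChart (g 0) (2 * Real.pi) ρ fun r φ => g (r * unitVec φ) := by
  have hn : ∀ {r : ℝ}, r ∈ Ico 0 ρ → ∀ φ, ‖r * unitVec φ‖ < ρ := fun hr φ => by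
    rw [norm_mul_unitVec hr.1]; exact hr.2
  refine ⟨Real.two_pi_pos, h.pos, by simp, ?_, ?_⟩
  · ext y
    constructor
    · rintro ⟨⟨r, φ⟩, ⟨hr, -⟩, rfl⟩
      rw [Metric.mem_ball, h.dist_zero (hn hr φ)]
      exact hn hr φ
    · intro hy
      obtain ⟨w, hw, rfl⟩ := h.surj y hy
      exact ⟨(‖w‖, w.arg), ⟨⟨norm_nonneg w, hw⟩, trivial⟩, by simp only [norm_mul_unitVec_arg]⟩
  · intro r hr s hs φ _ ψ _
    rw [h.dist_eq _ _ (hn hr φ) (hn hs ψ), coneDist_addCircle_two_pi]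
    rfl

lemma IsFoldedChart.isSectorChart {g : ℂ → D} (h : IsFoldedChart fold ρ g) :
    IsSectorChart (g 0) Real.pi ρ fun r φ => g (r * unitVec φ) := by
  have hn : ∀ {r : ℝ}, r ∈ Ico 0 ρ → ∀ φ, ‖r * unitVec φ‖ < ρ := fun hr φ => by
    rw [norm_mul_unitVec hr.1]; exact hr.2
  refine ⟨Real.pi_pos, h.pos, by simp, ?_, ?_⟩
  · ext y
    constructor
    · rintro ⟨⟨r, φ⟩, ⟨hr, -⟩, rfl⟩
      rw [Metric.mem_ball, h.dist_zero (hn hr φ)]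
      exact hn hr φ
    · intro hy
      obtain ⟨w, hw, rfl⟩ := h.surj y hy
      refine ⟨(‖w‖, |w.arg|), ⟨⟨norm_nonneg w, hw⟩, abs_nonneg _, Complex.abs_arg_le_pi _⟩, ?_⟩
      simp only [norm_mul_unitVec_abs_arg]
      exact h.apply_model hw
  · intro r hr s hs φ hφ ψ hψ
    rw [h.dist_eq _ _ (hn hr φ) (hn hs ψ), coneDist_of_abs_le, fold_real_mul hr.1,
      fold_real_mul hs.1, fold_unitVec hφ, fold_unitVec hψ]
    rw [abs_le]; constructor <;> linarith [hφ.1, hφ.2, hψ.1, hψ.2]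

lemma not_isSingularPoint_iff : ¬ IsSingularPoint p ↔ ∃ f : ℂ → D, FlatAt f 0 ∧ f 0 = p := by
  rw [IsSingularPoint, not_not]
  constructor
  · rintro ⟨ρ, e, h | h⟩
    · exact ⟨_, h.isFoldedChart.flatAt_zero, by simpa using h.2.center _ trivial⟩
    · exact ⟨_, h.isFoldedChart.flatAt_zero, by
        simpa using h.2.center _ ⟨le_rfl, Real.pi_pos.le⟩⟩
  · rintro ⟨f, ⟨L, κ, ρ, h⟩, rfl⟩
    have h0 : f 0 = f (0 + L 0) := by simp
    rw [h0]
    rcases h.model with rfl | rfl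
    · exact ⟨ρ, _, Or.inl h.isConeChart⟩
    · exact ⟨ρ, _, Or.inr h.isSectorChart⟩

lemma FlatAt.not_isSingularPoint {f : ℂ → D} {z : ℂ} (h : FlatAt f z) :
    ¬ IsSingularPoint (f z) := by
  obtain ⟨g, κ, ρ, hg, h0⟩ := h.exists_chart
  exact not_isSingularPoint_iff.2 ⟨g, hg.flatAt_zero, h0⟩

lemma exists_isFoldedChart (hp : ¬ IsSingularPoint p) :
    ∃ (g : ℂ → D) (κ : ℂ → ℂ) (ρ : ℝ), IsFoldedChart κ ρ g ∧ g 0 = p := by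
  obtain ⟨f, hf, rfl⟩ := not_isSingularPoint_iff.1 hp
  exact hf.exists_chart

/-- Near the time `t` the curve `γ` is the image under a flat map of a line with unit speed. -/
def FlatMotionAt (γ : ℝ → D) (t : ℝ) : Prop :=
  ∃ (f : ℂ → D) (z v : ℂ), ‖v‖ = 1 ∧ FlatAt f z ∧ ∀ᶠ s : ℝ in 𝓝 0, γ (t + s) = f (z + s * v)

lemma exists_pos_of_eventually_nhdsGE {P : ℝ → Prop} (h : ∀ᶠ s in 𝓝[≥] (0 : ℝ), P s) :
    ∃ δ > 0, ∀ s, 0 ≤ s → s < δ → P s := by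
  obtain ⟨δ, hδ, hs⟩ := mem_nhdsGE_iff_exists_Ico_subset.1 h
  exact ⟨δ, hδ, fun s h1 h2 => hs ⟨h1, h2⟩⟩

/-- In a sector of angle `π` the incoming direction `π - α` is the fold of `-unitVec α`, so the law
of reflection says that the path is a folded straight line. -/
lemma isBilliardMotionAt_iff {γ : ℝ → D} {t : ℝ} : IsBilliardMotionAt γ t ↔ FlatMotionAt γ t := by
  constructor
  · rintro (⟨ρ, e, α, h, hs⟩ | ⟨ρ, e, α, h, hα, hs⟩)
    · obtain ⟨δ, hδ, hs⟩ := exists_pos_of_eventually_nhdsGE hs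
      refine ⟨_, 0, unitVec α, norm_unitVec α, h.isFoldedChart.flatAt_zero, ?_⟩
      filter_upwards [Ioo_mem_nhds (neg_lt_zero.2 (lt_min hδ h.2.radius_pos))
        (lt_min hδ h.2.radius_pos)] with s hsm
      rw [zero_add]
      rcases le_total 0 s with h0 | h0
      · rw [(hs s h0 (hsm.2.trans_le (min_le_left _ _))).1]
        exact (h.apply_eq ⟨h0, hsm.2.trans_le (min_le_right _ _)⟩ α).symm
      · have h1 : -s < min δ ρ := by linarith [hsm.1]
        have := (hs (-s) (by linarith) (h1.trans_le (min_le_left _ _))).2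
        rw [sub_neg_eq_add] at this
        rw [this, ← h.apply_eq ⟨by linarith, h1.trans_le (min_le_right _ _)⟩, unitVec_add_pi]
        simp
    · obtain ⟨δ, hδ, hs⟩ := exists_pos_of_eventually_nhdsGE hs
      have hc := h.isFoldedChart
      refine ⟨_, 0, unitVec α, norm_unitVec α, hc.flatAt_zero, ?_⟩
      filter_upwards [Ioo_mem_nhds (neg_lt_zero.2 (lt_min hδ h.2.radius_pos))
        (lt_min hδ h.2.radius_pos)] with s hsm
      rw [zero_add]
      rcases le_total 0 s with h0 | h0
      · rw [(hs s h0 (hsm.2.trans_le (min_le_left _ _))).1]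
        exact (h.apply_eq ⟨h0, hsm.2.trans_le (min_le_right _ _)⟩ hα).symm
      · have h1 : -s < min δ ρ := by linarith [hsm.1]
        have h2 : -s ∈ Ico 0 ρ := ⟨by linarith, h1.trans_le (min_le_right _ _)⟩
        have := (hs (-s) (by linarith) (h1.trans_le (min_le_left _ _))).2
        rw [sub_neg_eq_add] at this
        rw [this, ← h.apply_eq h2 ⟨by linarith [hα.2], by linarith [hα.1]⟩]
        have hn : ‖(s : ℂ) * unitVec α‖ < ρ := by
          rw [norm_mul, norm_unitVec, mul_one, Complex.norm_real, Real.norm_of_nonpos h0]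
          exact h2.2
        refine (hc.apply_eq_iff (by rw [norm_mul_unitVec h2.1]; exact h2.2) hn).2 ?_
        rw [← fold_neg_unitVec hα, fold_real_mul h2.1, fold_fold, ← fold_real_mul h2.1]
        simp
  · rintro ⟨f, z, v, hv, ⟨L, κ, ρ, h⟩, hs⟩
    set a := L.symm v with ha
    have han : ‖a‖ = 1 := by rw [ha, L.symm.norm_map, hv]
    have hfg : ∀ s : ℝ, f (z + s * v) = f (z + L (s * a)) := fun s => by
      rw [← Complex.real_smul, ← Complex.real_smul, map_smul, ha, L.apply_symm_apply]
    have hγ : γ t = f (z + L 0) := by simpa using hs.self_of_nhds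
    have hs' : ∀ᶠ s : ℝ in 𝓝[≥] 0, γ (t + s) = f (z + L (s * a)) ∧
        γ (t - s) = f (z + L (-(s * a))) := by
      have hneg : Tendsto (fun s : ℝ => -s) (𝓝 0) (𝓝 0) := by simpa using tendsto_neg (0 : ℝ)
      filter_upwards [nhdsWithin_le_nhds hs, nhdsWithin_le_nhds (hneg.eventually hs)] with s h1 h2
      refine ⟨by rw [h1, hfg], ?_⟩
      rw [sub_eq_add_neg, h2, hfg]; simp
    rcases h.model with rfl | rfl
    · left
      refine ⟨ρ, _, a.arg, by rw [hγ]; exact h.isConeChart, ?_⟩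
      have haa : unitVec a.arg = a := by simpa [han] using norm_mul_unitVec_arg a
      filter_upwards [hs'] with s h1
      rw [unitVec_add_pi, haa, mul_neg]
      exact h1
    · right
      have hα : |a.arg| ∈ Icc 0 Real.pi := ⟨abs_nonneg _, Complex.abs_arg_le_pi _⟩
      refine ⟨ρ, _, |a.arg|, by rw [hγ]; exact h.isSectorChart, hα, ?_⟩
      have haa : unitVec |a.arg| = fold a := by simpa [han] using norm_mul_unitVec_abs_arg a
      filter_upwards [hs', self_mem_nhdsWithin, nhdsWithin_le_nhds (gt_mem_nhds h.pos)]
        with s h1 h0 hsρ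
      have hn : ‖(s : ℂ) * a‖ < ρ := by
        rw [norm_mul, han, mul_one, Complex.norm_real, Real.norm_of_nonneg h0]; exact hsρ
      rw [h1.1, h1.2]
      constructor
      · rw [haa, ← fold_real_mul h0]
        exact (h.apply_model hn).symm
      · rw [← fold_neg_unitVec hα, haa]
        refine (h.apply_eq_iff (by rwa [norm_neg]) ?_).2 ?_
        · rw [norm_mul, norm_fold, norm_neg, norm_fold, ← norm_mul]; exact hn
        · have e1 : -((s : ℂ) * a) = s * (-a) := by ring
          rw [e1, fold_real_mul h0, fold_real_mul h0, fold_fold]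
          congr 1
          apply Complex.ext <;> simp

end Charts

/-! ### Flatness of a polar chart off its centre -/

section Polar

variable {D : Type*} [MetricSpace D]

/-- In the polar coordinates `(r, ψ)` the map `Φ` is flat at `(r, ψ)`. -/
def PolarFlatAt (Φ : ℝ → ℝ → D) (r ψ : ℝ) : Prop :=
  ∃ f : ℂ → D, FlatAt f (r * unitVec ψ) ∧
    ∀ᶠ x : ℝ × ℝ in 𝓝 (r, ψ), Φ x.1 x.2 = f (x.1 * unitVec x.2)

lemma PolarFlatAt.flatMotionAt {Φ : ℝ → ℝ → D} {r ψ : ℝ} (h : PolarFlatAt Φ r ψ) :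
    FlatMotionAt (fun t => Φ t ψ) r := by
  obtain ⟨f, hf, hev⟩ := h
  refine ⟨f, r * unitVec ψ, unitVec ψ, norm_unitVec ψ, hf, ?_⟩
  have hc : Tendsto (fun s : ℝ => (r + s, ψ)) (𝓝 0) (𝓝 (r, ψ)) := by
    have : Continuous fun s : ℝ => (r + s, ψ) := by fun_prop
    simpa using this.tendsto 0
  filter_upwards [hc.eventually hev] with s hs
  rw [hs]; congr 1; push_cast; ring

lemma PolarFlatAt.congr {Φ Ψ : ℝ → ℝ → D} {r ψ : ℝ} (h : PolarFlatAt Φ r ψ)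
    (he : ∀ᶠ x : ℝ × ℝ in 𝓝 (r, ψ), Ψ x.1 x.2 = Φ x.1 x.2) : PolarFlatAt Ψ r ψ := by
  obtain ⟨f, hf, hev⟩ := h
  refine ⟨f, hf, ?_⟩
  filter_upwards [hev, he] with x h1 h2
  rw [h2, h1]

variable {A : Set ℝ} {ang : ℝ → ℝ → ℝ} {p : D} {ρ θ : ℝ} {e : ℝ → ℝ → D}

lemma IsPolarChart.dist_center (h : IsPolarChart A ang p ρ e) {r ψ : ℝ} (hr : r ∈ Ico 0 ρ)
    (hψ : ψ ∈ A) : dist (e r ψ) p = r := by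
  rw [← h.center ψ hψ, h.dist_eq r hr 0 ⟨le_rfl, h.radius_pos⟩ ψ hψ ψ hψ, coneDist_zero_right hr.1]

/-- A polar chart is flat at the points off its centre whose direction has a neighbourhood in which
angles are differences of coordinates. -/
lemma IsPolarChart.polarFlatAt (h : IsPolarChart A ang p ρ e) {r₀ ψ₀ η : ℝ} (hr : r₀ ∈ Ioo 0 ρ)
    (hη : 0 < η) (hηπ : η < Real.pi / 2)
    (hA : ∀ ψ, |ψ - ψ₀| < η → ψ ∈ A)
    (hang : ∀ φ ψ, |φ - ψ₀| < η → |ψ - ψ₀| < η → ang φ ψ = |φ - ψ|)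
    (hrep : ∀ φ ∈ A, ang φ ψ₀ < η → ∃ ψ, |ψ - ψ₀| < η ∧ ∀ s ∈ Ico 0 ρ, e s ψ = e s φ) :
    PolarFlatAt e r₀ ψ₀ := by
  have hr0 : r₀ ∈ Ico 0 ρ := ⟨hr.1.le, hr.2⟩
  have hψ₀ : |ψ₀ - ψ₀| < η := by simpa using hη
  -- the argument relative to `ψ₀`
  set a : ℂ → ℝ := fun z => ψ₀ + (z * unitVec (-ψ₀)).arg with ha
  have ha' : ∀ {r ψ : ℝ}, 0 < r → |ψ - ψ₀| < η → a (r * unitVec ψ) = ψ := by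
    intro r ψ h0 hψ
    have h1 : r * unitVec ψ * unitVec (-ψ₀) = r * unitVec (ψ - ψ₀) := by
      rw [mul_assoc, ← unitVec_add, sub_eq_add_neg]
    rw [abs_lt] at hψ
    simp only [ha]
    rw [h1, Complex.arg_real_mul _ h0, unitVec, Complex.arg_exp_mul_I,
      (toIocMod_eq_self Real.two_pi_pos).2]
    · ring
    · constructor <;> linarith
  have hza : ∀ z, ‖z‖ * unitVec (a z) = z := by
    intro z
    have h1 := norm_mul_unitVec_arg (z * unitVec (-ψ₀))
    rw [norm_mul, norm_unitVec, mul_one] at h1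
    simp only [ha]
    rw [add_comm, unitVec_add, ← mul_assoc, h1, mul_assoc, ← unitVec_add]
    simp [unitVec]
  set z₀ : ℂ := r₀ * unitVec ψ₀ with hz₀
  have haz : a z₀ = ψ₀ := ha' hr.1 hψ₀
  have hnz : ‖z₀‖ = r₀ := norm_mul_unitVec hr0.1 _
  have hcont : ContinuousAt a z₀ := by
    have h1 : z₀ * unitVec (-ψ₀) = (r₀ : ℂ) := by
      rw [hz₀, mul_assoc, ← unitVec_add]; simp [unitVec]
    have h2 : ContinuousAt Complex.arg (z₀ * unitVec (-ψ₀)) := by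
      rw [h1]; exact Complex.continuousAt_arg (Or.inl (by simpa using hr.1))
    have h3 : ContinuousAt (fun z : ℂ => z * unitVec (-ψ₀)) z₀ := by fun_prop
    exact continuousAt_const.add (ContinuousAt.comp (f := fun z : ℂ => z * unitVec (-ψ₀)) h2 h3)
  obtain ⟨ρ₁, hρ₁, hball⟩ : ∃ ρ₁ > 0, ∀ w : ℂ, ‖w‖ < ρ₁ →
      ‖z₀ + w‖ ∈ Ico 0 ρ ∧ |a (z₀ + w) - ψ₀| < η := by
    have e1 : ∀ᶠ z in 𝓝 z₀, ‖z‖ < ρ := continuous_norm.continuousAt.eventually_lt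
      continuousAt_const (by rw [hnz]; exact hr.2)
    have e2 : ∀ᶠ z in 𝓝 z₀, |a z - ψ₀| < η := by
      have hc : ContinuousAt (fun z => |a z - ψ₀|) z₀ := (hcont.sub continuousAt_const).abs
      exact hc.eventually_lt continuousAt_const (by rwa [haz])
    obtain ⟨ρ₁, h1, h2⟩ := Metric.eventually_nhds_iff.1 (e1.and e2)
    refine ⟨ρ₁, h1, fun w hw => ?_⟩
    obtain ⟨h3, h4⟩ := h2 (y := z₀ + w) (by simpa using hw)
    exact ⟨⟨norm_nonneg _, h3⟩, h4⟩
  have hdist : ∀ {r s φ ψ : ℝ}, r ∈ Ico 0 ρ → s ∈ Ico 0 ρ → |φ - ψ₀| < η → |ψ - ψ₀| < η →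
      dist (e r φ) (e s ψ) = ‖r * unitVec φ - s * unitVec ψ‖ := by
    intro r s φ ψ h1 h2 h3 h4
    rw [h.dist_eq r h1 s h2 φ (hA φ h3) ψ (hA ψ h4), hang φ ψ h3 h4, coneDist_of_abs_le]
    have := abs_sub_le φ ψ₀ ψ
    rw [abs_sub_comm ψ₀ ψ] at this
    linarith
  have hsin : 0 < Real.sin η := Real.sin_pos_of_pos_of_lt_pi hη (by linarith [Real.pi_pos])
  -- The four bounds keep the coordinates in the range of `hball`, keep points inside the ball about
  -- `p`, keep them off the centre, and keep their directions within `η` of `ψ₀`.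
  set ρ₂ := min ρ₁ (min (ρ - r₀) (min r₀ (r₀ * Real.sin η))) with hρ₂
  have hρ₂pos : 0 < ρ₂ := by
    have := hr.1
    have := hr.2
    refine lt_min hρ₁ (lt_min (by linarith) (lt_min hr.1 (by positivity)))
  have b1 : ρ₂ ≤ ρ₁ := min_le_left _ _
  have b2 : ρ₂ ≤ ρ - r₀ := (min_le_right _ _).trans (min_le_left _ _)
  have b3 : ρ₂ ≤ r₀ := (min_le_right _ _).trans ((min_le_right _ _).trans (min_le_left _ _))
  have b4 : ρ₂ ≤ r₀ * Real.sin η :=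
    (min_le_right _ _).trans ((min_le_right _ _).trans (min_le_right _ _))
  refine ⟨fun z => e ‖z‖ (a z), ⟨LinearIsometryEquiv.refl ℝ ℂ, id, ρ₂, Or.inl rfl, hρ₂pos,
    fun w w' hw hw' => ?_, fun y hy => ?_⟩, ?_⟩
  · obtain ⟨h1, h2⟩ := hball w (hw.trans_le b1)
    obtain ⟨h3, h4⟩ := hball w' (hw'.trans_le b1)
    simp only [LinearIsometryEquiv.coe_refl, id]
    rw [hdist h1 h3 h2 h4, hza, hza, add_sub_add_left_eq_sub]
  · simp only [LinearIsometryEquiv.coe_refl, id, add_zero, ← hz₀, hnz, haz] at hy ⊢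
    have hyp : y ∈ Metric.ball p ρ := by
      have h1 := dist_triangle y (e r₀ ψ₀) p
      rw [h.dist_center hr0 (hA _ hψ₀)] at h1
      rw [Metric.mem_ball]; linarith
    rw [← h.image_eq] at hyp
    obtain ⟨⟨s, φ⟩, ⟨hs, hφ⟩, rfl⟩ := hyp
    simp only at hy hs hφ ⊢
    obtain ⟨ψ, hψ, hψe⟩ : ∃ ψ, |ψ - ψ₀| < η ∧ ∀ s ∈ Ico 0 ρ, e s ψ = e s φ := by
      refine hrep φ hφ ?_
      by_contra hcon
      have h1 := mul_sin_le_coneDist hr0.1 hs.1 hη.le (by linarith) (not_lt.1 hcon)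
      rw [← h.dist_eq s hs r₀ hr0 φ hφ ψ₀ (hA _ hψ₀)] at h1
      linarith
    rw [← hψe s hs] at hy ⊢
    rw [hdist hs hr0 hψ hψ₀] at hy
    have hs0 : 0 < s := by
      rcases hs.1.eq_or_lt with h0 | h0
      · rw [← h0] at hy; simp [abs_of_pos hr.1] at hy; linarith
      · exact h0
    refine ⟨s * unitVec ψ - z₀, hy, ?_⟩
    rw [add_sub_cancel, norm_mul_unitVec hs.1, ha' hs0 hψ]
  · have e1 : ∀ᶠ x : ℝ × ℝ in 𝓝 (r₀, ψ₀), 0 < x.1 :=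
      continuousAt_const.eventually_lt continuous_fst.continuousAt hr.1
    have e2 : ∀ᶠ x : ℝ × ℝ in 𝓝 (r₀, ψ₀), |x.2 - ψ₀| < η := by
      have : Continuous fun x : ℝ × ℝ => |x.2 - ψ₀| := by fun_prop
      exact this.continuousAt.eventually_lt continuousAt_const hψ₀
    filter_upwards [e1, e2] with x h1 h2
    rw [norm_mul_unitVec h1.le, ha' h1 h2]

lemma IsConeChart.apply_sub_int_mul (h : IsConeChart p θ ρ e) {s : ℝ} (hs : s ∈ Ico 0 ρ) (φ : ℝ)
    (n : ℤ) : e s (φ - n * θ) = e s φ := by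
  rw [← dist_eq_zero, h.2.dist_eq s hs s hs _ trivial _ trivial]
  have h1 : ((φ - n * θ - φ : ℝ) : AddCircle θ) = 0 :=
    (AddCircle.coe_eq_zero_iff θ).2 ⟨-n, by simp⟩
  rw [h1, norm_zero]
  exact le_antisymm (by simpa using coneDist_self_le hs.1 le_rfl) (Real.sqrt_nonneg _)

lemma IsConeChart.polarFlatAt (h : IsConeChart p θ ρ e) {r ψ : ℝ} (hr : r ∈ Ioo 0 ρ) :
    PolarFlatAt e r ψ := by
  have hθ := h.1
  -- Two directions within `θ / 4` of `ψ` differ by less than half a turn of the cone, so the norm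
  -- of `AddCircle θ` is the ordinary absolute value there.
  have hη : 0 < min (θ / 4) (Real.pi / 4) := lt_min (by positivity) (by positivity)
  refine h.2.polarFlatAt (η := min (θ / 4) (Real.pi / 4)) hr hη
    ((min_le_right _ _).trans_lt (by linarith [Real.pi_pos])) (fun _ _ => trivial) ?_ ?_
  · intro φ φ' h1 h2
    rw [AddCircle.norm_coe_eq_abs_iff θ hθ.ne', abs_of_pos hθ]
    have h3 := abs_sub_le φ ψ φ'
    rw [abs_sub_comm ψ φ'] at h3
    have h4 := min_le_left (θ / 4) (Real.pi / 4)
    linarith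
  · intro φ _ h1
    refine ⟨φ - round (θ⁻¹ * (φ - ψ)) * θ, ?_, fun s hs => h.apply_sub_int_mul hs φ _⟩
    rw [AddCircle.norm_eq] at h1
    rwa [sub_right_comm] at h1

lemma IsSectorChart.polarFlatAt (h : IsSectorChart p θ ρ e) {r ψ : ℝ} (hr : r ∈ Ioo 0 ρ)
    (hψ : ψ ∈ Ioo 0 θ) : PolarFlatAt e r ψ := by
  have hψ1 := hψ.1
  have hψ2 := hψ.2
  set η := min (min ψ (θ - ψ)) (Real.pi / 4) with hηdef
  have hη : 0 < η := lt_min (lt_min hψ1 (by linarith)) (by positivity)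
  have b1 : η ≤ ψ := (min_le_left _ _).trans (min_le_left _ _)
  have b2 : η ≤ θ - ψ := (min_le_left _ _).trans (min_le_right _ _)
  refine h.2.polarFlatAt (η := η) hr hη
    ((min_le_right _ _).trans_lt (by linarith [Real.pi_pos])) ?_ (fun _ _ _ _ => rfl)
    fun φ _ h1 => ⟨φ, h1, fun _ _ => rfl⟩
  intro φ h1
  rw [abs_lt] at h1
  constructor <;> linarith

/-- `e` is a polar chart at `p`, whose directions are parametrized by `[0, θ]`. -/
def IsConeOrSectorChart (p : D) (θ ρ : ℝ) (e : ℝ → ℝ → D) : Prop :=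
  IsConeChart p θ ρ e ∨ IsSectorChart p θ ρ e

namespace IsConeOrSectorChart

lemma angle_pos (h : IsConeOrSectorChart p θ ρ e) : 0 < θ := h.elim (fun h => h.1) fun h => h.1

lemma radius_pos (h : IsConeOrSectorChart p θ ρ e) : 0 < ρ :=
  h.elim (fun h => h.2.radius_pos) fun h => h.2.radius_pos

lemma polarFlatAt (h : IsConeOrSectorChart p θ ρ e) {r ψ : ℝ} (hr : r ∈ Ioo 0 ρ)
    (hψ : ψ ∈ Ioo 0 θ) : PolarFlatAt e r ψ :=
  h.elim (fun h => h.polarFlatAt hr) fun h => h.polarFlatAt hr hψ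

lemma dist_center (h : IsConeOrSectorChart p θ ρ e) {r ψ : ℝ} (hr : r ∈ Ico 0 ρ)
    (hψ : ψ ∈ Ioo 0 θ) : dist (e r ψ) p = r :=
  h.elim (fun h => h.2.dist_center hr trivial)
    fun h => h.2.dist_center hr (Ioo_subset_Icc_self hψ)

/-- The points off the centre with interior directions are dense in the ball of the chart. -/
lemma exists_dist_lt (h : IsConeOrSectorChart p θ ρ e) {y : D} (hy : dist y p < ρ)
    {ε : ℝ} (hε : 0 < ε) :
    ∃ r ∈ Ioo 0 ρ, ∃ ψ ∈ Ioo 0 θ, dist (e r ψ) y < ε := by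
  have hθ := h.angle_pos
  have hρ := h.radius_pos
  by_cases hyp : y = p
  · have hm : 0 < min ρ ε := lt_min hρ hε
    refine ⟨min ρ ε / 2, ⟨by positivity, ?_⟩, θ / 2, ⟨by positivity, by linarith⟩, ?_⟩
    · linarith [min_le_left ρ ε]
    · rw [hyp, h.dist_center ⟨by positivity, by linarith [min_le_left ρ ε]⟩
        ⟨by positivity, by linarith⟩]
      linarith [min_le_right ρ ε]
  have hypos : 0 < dist y p := dist_pos.2 hyp
  have hcl : ∀ φ ∈ Icc 0 θ, ∃ ψ ∈ Ioo 0 θ, |ψ - φ| < ε / ρ := by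
    intro φ hφ
    rw [← closure_Ioo hθ.ne] at hφ
    obtain ⟨ψ, hψ, hd⟩ := Metric.mem_closure_iff.1 hφ (ε / ρ) (by positivity)
    exact ⟨ψ, hψ, by rwa [dist_comm] at hd⟩
  have hfin : ∀ r ∈ Ico 0 ρ, ∀ δ, 0 ≤ δ → δ < ε / ρ → coneDist r r δ < ε := by
    intro r hr δ h0 hδ
    rw [lt_div_iff₀ hρ] at hδ
    nlinarith [coneDist_self_le hr.1 h0, hr.1, hr.2]
  rcases h with h | h
  · have hyb : y ∈ Metric.ball p ρ := hy
    rw [← h.2.image_eq] at hyb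
    obtain ⟨⟨r, φ⟩, ⟨hr, -⟩, rfl⟩ := hyb
    have hd := h.2.dist_center hr (mem_univ φ)
    simp only at hr hypos ⊢
    have hmem : φ - ⌊φ / θ⌋ * θ ∈ Icc 0 θ := by
      have h1 := Int.floor_le (φ / θ)
      have h2 := Int.lt_floor_add_one (φ / θ)
      rw [le_div_iff₀ hθ] at h1
      rw [div_lt_iff₀ hθ] at h2
      constructor <;> nlinarith
    obtain ⟨ψ, hψ, hψd⟩ := hcl _ hmem
    refine ⟨r, ⟨by rwa [hd] at hypos, hr.2⟩, ψ, hψ, ?_⟩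
    rw [← h.apply_sub_int_mul hr φ ⌊φ / θ⌋, h.2.dist_eq r hr r hr _ trivial _ trivial]
    refine hfin r hr _ (norm_nonneg _) (lt_of_le_of_lt ?_ hψd)
    exact QuotientAddGroup.norm_mk_le_norm
  · have hyb : y ∈ Metric.ball p ρ := hy
    rw [← h.2.image_eq] at hyb
    obtain ⟨⟨r, φ⟩, ⟨hr, hφ⟩, rfl⟩ := hyb
    have hd := h.2.dist_center hr hφ
    simp only at hr hypos hφ ⊢
    obtain ⟨ψ, hψ, hψd⟩ := hcl _ hφ
    refine ⟨r, ⟨by rwa [hd] at hypos, hr.2⟩, ψ, hψ, ?_⟩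
    rw [h.2.dist_eq r hr r hr _ (Ioo_subset_Icc_self hψ) _ hφ]
    exact hfin r hr _ (abs_nonneg _) hψd

end IsConeOrSectorChart

end Polar

/-! ### Continuous induction and uniqueness of motions -/

/-- Continuous induction on a closed interval. -/
lemma continuous_induction {Q : ℝ → Prop} {a b : ℝ} (hab : a ≤ b)
    (hanti : ∀ x y, x ≤ y → Q y → Q x) (ha : Q a)
    (hstep : ∀ x, a ≤ x → x ≤ b → (∀ y < x, Q y) → ∃ x' > x, Q x') : Q b := by
  by_contra hb
  set S := {x | x ≤ b ∧ Q x} with hS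
  have hSa : a ∈ S := ⟨hab, ha⟩
  have hbdd : BddAbove S := ⟨b, fun x hx => hx.1⟩
  have h1 : a ≤ sSup S := le_csSup hbdd hSa
  have h2 : sSup S ≤ b := csSup_le ⟨a, hSa⟩ fun x hx => hx.1
  obtain ⟨x', hx', hQ⟩ := hstep _ h1 h2 fun y hy => by
    obtain ⟨z, hz, hyz⟩ := exists_lt_of_lt_csSup ⟨a, hSa⟩ hy
    exact hanti _ _ hyz.le hz.2
  rcases le_total x' b with h | h
  · exact absurd (le_csSup hbdd ⟨h, hQ⟩) (not_le.2 hx')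
  · exact hb (hanti _ _ h hQ)

section Motion

variable {D : Type*} [MetricSpace D]

lemma dist_le_of_locally_lipschitz {h : ℝ → D} {a b K : ℝ} (hab : a ≤ b)
    (hloc : ∀ x ∈ Icc a b, ∃ δ > 0, ∀ y y', |y - x| < δ → |y' - x| < δ →
      dist (h y) (h y') ≤ K * |y - y'|) : dist (h a) (h b) ≤ K * (b - a) := by
  have := continuous_induction (Q := fun x => ∀ t, a ≤ t → t ≤ x → dist (h a) (h t) ≤ K * (t - a))
    hab (fun x y hxy hy t h1 h2 => hy t h1 (h2.trans hxy))
    (fun t h1 h2 => by rw [le_antisymm h2 h1]; simp) ?_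
  · exact this b hab le_rfl
  · intro x hax hxb hlt
    obtain ⟨δ, hδ, hl⟩ := hloc x ⟨hax, hxb⟩
    refine ⟨x + δ / 2, by linarith, fun t h1 h2 => ?_⟩
    rcases lt_or_ge t x with htx | htx
    · exact hlt t htx t h1 le_rfl
    -- `y` is a point shortly before `x`, where the estimate is already known, and within reach of
    -- the local one.
    set y := max a (x - δ / 2) with hy
    have hyx : y ≤ x := max_le hax (by linarith)
    have hay : a ≤ y := le_max_left _ _
    have hd : dist (h a) (h y) ≤ K * (y - a) := by
      rcases hyx.eq_or_lt with he | hlt'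
      · have : a = y := by
          rcases max_choice a (x - δ / 2) with hm | hm
          · exact hm.symm
          · rw [← hy] at hm; linarith
        rw [← this]; simp
      · exact hlt y hlt' y hay le_rfl
    have hd2 := hl y t (by rw [abs_lt]; constructor <;> linarith [le_max_right a (x - δ / 2)])
      (by rw [abs_lt]; constructor <;> linarith)
    rw [abs_sub_comm, abs_of_nonneg (by linarith)] at hd2
    linarith [dist_triangle (h a) (h y) (h t)]

namespace FlatMotionAt

variable {γ γ' : ℝ → D} {t : ℝ}

lemma congr (h : FlatMotionAt γ t) (he : γ' =ᶠ[𝓝 t] γ) : FlatMotionAt γ' t := by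
  obtain ⟨f, z, v, hv, hf, hs⟩ := h
  refine ⟨f, z, v, hv, hf, ?_⟩
  have hc : Tendsto (fun s : ℝ => t + s) (𝓝 0) (𝓝 t) := by
    have : Continuous fun s : ℝ => t + s := by fun_prop
    simpa using this.tendsto 0
  filter_upwards [hs, hc.eventually he] with s h1 h2
  rw [h2, h1]

lemma not_isSingularPoint (h : FlatMotionAt γ t) : ¬ IsSingularPoint (γ t) := by
  obtain ⟨f, z, v, hv, hf, hs⟩ := h
  have : γ t = f z := by simpa using hs.self_of_nhds
  rw [this]; exact hf.not_isSingularPoint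

lemma exists_lipschitz (h : FlatMotionAt γ t) :
    ∃ δ > 0, ∀ y y', |y - t| < δ → |y' - t| < δ → dist (γ y) (γ y') ≤ 1 * |y - y'| := by
  obtain ⟨f, z, v, hv, hf, hs⟩ := h
  obtain ⟨δ, hδ, hl⟩ := hf.exists_lipschitz
  obtain ⟨δ', hδ', hs⟩ := Metric.eventually_nhds_iff.1 hs
  refine ⟨min δ δ', lt_min hδ hδ', fun y y' hy hy' => ?_⟩
  have e1 := hs (y := y - t) (by simpa using hy.trans_le (min_le_right _ _))
  have e2 := hs (y := y' - t) (by simpa using hy'.trans_le (min_le_right _ _))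
  rw [add_sub_cancel] at e1 e2
  have hn : ∀ r : ℝ, ‖(r : ℂ) * v‖ = |r| := fun r => by simp [hv]
  rw [e1, e2]
  refine (hl _ _ ?_ ?_).trans_eq ?_
  · rw [add_sub_cancel_left, hn]; exact hy.trans_le (min_le_left _ _)
  · rw [add_sub_cancel_left, hn]; exact hy'.trans_le (min_le_left _ _)
  · rw [add_sub_add_left_eq_sub, ← sub_mul, ← Complex.ofReal_sub, hn, one_mul,
      sub_sub_sub_cancel_right]

lemma continuousAt (h : FlatMotionAt γ t) : ContinuousAt γ t := by
  obtain ⟨δ, hδ, hl⟩ := h.exists_lipschitz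
  rw [Metric.continuousAt_iff]
  intro ε hε
  refine ⟨min δ ε, lt_min hδ hε, fun {x} hx => ?_⟩
  rw [Real.dist_eq] at hx
  have := hl x t (hx.trans_le (min_le_left _ _)) (by simpa using hδ)
  linarith [min_le_right δ ε]

lemma local_unique (h : FlatMotionAt γ t) (h' : FlatMotionAt γ' t) (h0 : γ t = γ' t) :
    ∃ δ > 0, ∀ s, s ≠ t → |s - t| < δ → γ s = γ' s → ∀ r, |r - t| < δ → γ r = γ' r := by
  obtain ⟨f, z, v, hv, hf, hs⟩ := h
  obtain ⟨f', z', v', hv', hf', hs'⟩ := h'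
  have e0 : γ t = f z := by simpa using hs.self_of_nhds
  have e0' : γ' t = f' z' := by simpa using hs'.self_of_nhds
  obtain ⟨δ, hδ, hu⟩ := hf.line_unique hf' (by rw [← e0, ← e0', h0]) v v'
  obtain ⟨δ', hδ', hb⟩ := Metric.eventually_nhds_iff.1 (hs.and hs')
  refine ⟨min δ δ', lt_min hδ hδ', fun s hst hsδ hse r hr => ?_⟩
  have key : ∀ r, |r - t| < min δ δ' → γ r = f (z + (r - t : ℝ) * v) ∧
      γ' r = f' (z' + (r - t : ℝ) * v') := by
    intro r hr
    have := hb (y := r - t) (by simpa using hr.trans_le (min_le_right _ _))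
    rwa [add_sub_cancel] at this
  rw [(key r hr).1, (key r hr).2]
  refine hu (s - t) (sub_ne_zero.2 hst) (hsδ.trans_le (min_le_left _ _)) ?_ (r - t)
    (hr.trans_le (min_le_left _ _))
  rw [← (key s hsδ).1, ← (key s hsδ).2, hse]

/-- Two motions which agree for some time agree for ever. -/
lemma eq_of_eqOn {a c t₀ : ℝ} (hac : a < c) (hat : a < t₀)
    (h : ∀ t ∈ Ioc a t₀, FlatMotionAt γ t) (h' : ∀ t ∈ Ioc a t₀, FlatMotionAt γ' t)
    (he : ∀ t ∈ Ioo a c, γ t = γ' t) : γ t₀ = γ' t₀ := by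
  obtain ⟨c', hc'1, hc'2⟩ := exists_between (lt_min hac hat)
  have := continuous_induction (Q := fun x => ∀ t, a < t → t ≤ x → γ t = γ' t)
    (hc'2.le.trans (min_le_right _ _)) (fun x y hxy hy t h1 h2 => hy t h1 (h2.trans hxy))
    (fun t h1 h2 => he t ⟨h1, (h2.trans_lt hc'2).trans_le (min_le_left _ _)⟩) ?_
  · exact this t₀ hat le_rfl
  · intro x hcx hxt hlt
    have hax : a < x := hc'1.trans_le hcx
    have hxm : x ∈ Ioc a t₀ := ⟨hax, hxt⟩
    have hev : γ =ᶠ[𝓝[<] x] γ' := by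
      filter_upwards [Ioo_mem_nhdsLT hax] with s hs
      exact hlt s hs.2 s hs.1 le_rfl
    have hx0 : γ x = γ' x := tendsto_nhds_unique
      (((h x hxm).continuousAt.tendsto.mono_left nhdsWithin_le_nhds).congr' hev)
      ((h' x hxm).continuousAt.tendsto.mono_left nhdsWithin_le_nhds)
    -- Agreement at `x` alone would leave the direction open; agreement at an earlier time `s` near
    -- `x` fixes it.
    obtain ⟨δ, hδ, hu⟩ := (h x hxm).local_unique (h' x hxm) hx0
    obtain ⟨s, hs1, hs2⟩ := exists_between (max_lt hax (sub_lt_self x hδ))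
    have hs3 : x - δ < s := (le_max_right _ _).trans_lt hs1
    have hs4 : a < s := (le_max_left _ _).trans_lt hs1
    refine ⟨x + δ / 2, by linarith, fun t h1 h2 => ?_⟩
    rcases lt_or_ge t x with htx | htx
    · exact hlt t htx t h1 le_rfl
    · exact hu s hs2.ne (by rw [abs_lt]; constructor <;> linarith) (hlt s hs2 s hs4 le_rfl) t
        (by rw [abs_lt]; constructor <;> linarith)

end FlatMotionAt

/-- A flat map moves along a line of its domain by a flat motion. -/
lemma FlatAt.flatMotionAt {f : ℂ → D} {z v : ℂ} {t : ℝ} (hv : ‖v‖ = 1)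
    (h : FlatAt f (z + t * v)) : FlatMotionAt (fun s : ℝ => f (z + s * v)) t :=
  ⟨f, z + t * v, v, hv, h, Eventually.of_forall fun s => by
    change f _ = f _; congr 1; push_cast; ring⟩

lemma FlatMotionAt.const_sub {γ : ℝ → D} {c t : ℝ} (h : FlatMotionAt γ (c - t)) :
    FlatMotionAt (fun s => γ (c - s)) t := by
  obtain ⟨f, z, v, hv, hf, hs⟩ := h
  refine ⟨f, z, -v, by rwa [norm_neg], hf, ?_⟩
  have hneg : Tendsto (fun s : ℝ => -s) (𝓝 0) (𝓝 0) := by simpa using tendsto_neg (0 : ℝ)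
  filter_upwards [hneg.eventually hs] with s h1
  have : c - (t + s) = c - t + -s := by ring
  rw [this, h1]; simp

end Motion

/-! ### The flow and flat sectors of trajectories -/

section Flow

variable {D : Type*} [MetricSpace D] {e : ℝ → ℝ → D}

/-- `γ` leaves the centre of the polar chart `e` in the direction `ψ` and moves as a billiard ball
until the time `R`. -/
def IsRay (e : ℝ → ℝ → D) (ψ R : ℝ) (γ : ℝ → D) : Prop :=
  (∀ᶠ s in 𝓝[≥] (0 : ℝ), γ s = e s ψ) ∧ ∀ t ∈ Ioo 0 R, FlatMotionAt γ t

lemma IsRay.unique {ψ R R' : ℝ} {γ γ' : ℝ → D} (h : IsRay e ψ R γ) (h' : IsRay e ψ R' γ') {t : ℝ}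
    (h0 : 0 ≤ t) (hR : t < R) (hR' : t < R') : γ t = γ' t := by
  obtain ⟨δ, hδ, hs⟩ := exists_pos_of_eventually_nhdsGE (h.1.and h'.1)
  have hsame : ∀ s, 0 ≤ s → s < δ → γ s = γ' s := fun s h1 h2 => by
    rw [(hs s h1 h2).1, (hs s h1 h2).2]
  rcases h0.eq_or_lt with rfl | h0
  · exact hsame 0 le_rfl hδ
  · exact FlatMotionAt.eq_of_eqOn hδ h0 (fun s hs => h.2 s ⟨hs.1, hs.2.trans_lt hR⟩)
      (fun s hs => h'.2 s ⟨hs.1, hs.2.trans_lt hR'⟩) (fun s hs => hsame s hs.1.le hs.2)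

open Classical in
/-- The point reached at the time `t` by the billiard trajectory from the centre of the polar chart
`e` in the direction `ψ`. -/
noncomputable def flow (e : ℝ → ℝ → D) (t ψ : ℝ) : D :=
  if h : ∃ (γ : ℝ → D) (R : ℝ), t < R ∧ IsRay e ψ R γ then h.choose t else e 0 ψ

lemma IsRay.flow_eq {ψ R : ℝ} {γ : ℝ → D} (h : IsRay e ψ R γ) {t : ℝ} (h0 : 0 ≤ t) (hR : t < R) :
    flow e t ψ = γ t := by
  have hex : ∃ (γ : ℝ → D) (R : ℝ), t < R ∧ IsRay e ψ R γ := ⟨γ, R, hR, h⟩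
  obtain ⟨R', hR', h'⟩ := hex.choose_spec
  rw [flow, dif_pos hex]
  exact h'.unique h h0 hR' hR

/-- The trajectories in the directions near `ψ` are defined until the time `r` and sweep out a flat
sector. -/
def IsFree (e : ℝ → ℝ → D) (ψ r : ℝ) : Prop :=
  ∃ δ > 0, ∀ ψ', |ψ' - ψ| < δ → (∀ᶠ s in 𝓝[≥] (0 : ℝ), flow e s ψ' = e s ψ') ∧
    ∀ t ∈ Ioo 0 r, PolarFlatAt (flow e) t ψ'

namespace IsFree

variable {ψ r : ℝ}

lemma mono (h : IsFree e ψ r) {r' : ℝ} (hr : r' ≤ r) : IsFree e ψ r' := by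
  obtain ⟨δ, hδ, hs⟩ := h
  exact ⟨δ, hδ, fun ψ' h' => ⟨(hs ψ' h').1, fun t ht => (hs ψ' h').2 t ⟨ht.1, ht.2.trans_le hr⟩⟩⟩

lemma eventually (h : IsFree e ψ r) : ∀ᶠ ψ' in 𝓝 ψ, IsFree e ψ' r := by
  obtain ⟨δ, hδ, hs⟩ := h
  filter_upwards [Metric.ball_mem_nhds ψ (half_pos hδ)] with ψ' h'
  rw [Metric.mem_ball, Real.dist_eq] at h'
  exact ⟨δ / 2, half_pos hδ, fun φ hφ => hs φ (by linarith [abs_sub_le φ ψ' ψ])⟩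

lemma polarFlatAt (h : IsFree e ψ r) {t : ℝ} (ht : t ∈ Ioo 0 r) : PolarFlatAt (flow e) t ψ := by
  obtain ⟨δ, hδ, hs⟩ := h
  exact (hs ψ (by simpa using hδ)).2 t ht

lemma start (h : IsFree e ψ r) : ∀ᶠ s in 𝓝[≥] (0 : ℝ), flow e s ψ = e s ψ := by
  obtain ⟨δ, hδ, hs⟩ := h
  exact (hs ψ (by simpa using hδ)).1

end IsFree

lemma IsConeOrSectorChart.isFree {p : D} {θ ρ : ℝ} (h : IsConeOrSectorChart p θ ρ e) {ψ : ℝ}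
    (hψ : ψ ∈ Ioo 0 θ) : IsFree e ψ ρ := by
  have hρ := h.radius_pos
  have hray : ∀ φ ∈ Ioo 0 θ, IsRay e φ ρ fun t => e t φ := fun φ hφ =>
    ⟨Eventually.of_forall fun _ => rfl, fun t ht => (h.polarFlatAt ht hφ).flatMotionAt⟩
  have hflow : ∀ φ ∈ Ioo 0 θ, ∀ t, 0 ≤ t → t < ρ → flow e t φ = e t φ :=
    fun φ hφ t h0 hR => (hray φ hφ).flow_eq h0 hR
  obtain ⟨δ, hδ, hball⟩ := Metric.isOpen_iff.1 (isOpen_Ioo (a := 0) (b := θ)) ψ hψ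
  refine ⟨δ, hδ, fun φ hφ => ?_⟩
  have hφ' : φ ∈ Ioo 0 θ := hball (by rwa [Metric.mem_ball, Real.dist_eq])
  refine ⟨?_, fun t ht => (h.polarFlatAt ht hφ').congr ?_⟩
  · filter_upwards [Ico_mem_nhdsGE hρ] with s hs
    exact hflow φ hφ' s hs.1 hs.2
  · filter_upwards [prod_mem_nhds (isOpen_Ioo.mem_nhds ht) (isOpen_Ioo.mem_nhds hφ')] with x hx
    exact hflow _ hx.2 _ hx.1.1.le hx.1.2

/-- A sector swept out by trajectories extends across a nonsingular limit point. -/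
lemma exists_isFree_of_tendsto {ψ₀ r : ℝ} {x : D} (hr : 0 < r) (hfree : ∀ r' < r, IsFree e ψ₀ r')
    (hx : ¬ IsSingularPoint x) (hlim : Tendsto (fun t => flow e t ψ₀) (𝓝[<] r) (𝓝 x)) :
    ∃ r' > r, IsFree e ψ₀ r' := by
  obtain ⟨g, κ, ρ, hg, rfl⟩ := exists_isFoldedChart hx
  have hρ := hg.pos
  -- From `t₀ > r - ρ / 8`, continuing until `t₀ + ρ / 4` passes `r`. The path stays in the chart:
  -- `ρ / 8` for the starting point, `ρ / 4` for the time elapsed and `ρ / 8` for the change of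
  -- direction add up to less than `ρ`.
  obtain ⟨t₀, ⟨ht₀0, ht₀r, ht₀ρ⟩, hdist⟩ : ∃ t₀, (0 < t₀ ∧ t₀ < r ∧ r - ρ / 8 < t₀) ∧
      dist (flow e t₀ ψ₀) (g 0) < ρ / 8 := by
    have e1 : ∀ᶠ t in 𝓝[<] r, dist (flow e t ψ₀) (g 0) < ρ / 8 :=
      hlim.eventually (Metric.ball_mem_nhds (g 0) (by positivity))
    have e2 := Ioo_mem_nhdsLT (show max 0 (r - ρ / 8) < r from max_lt hr (by linarith))
    obtain ⟨t₀, h1, h2⟩ := (e1.and e2).exists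
    exact ⟨t₀, ⟨(le_max_left _ _).trans_lt h2.1, h2.2, (le_max_right _ _).trans_lt h2.1⟩, h1⟩
  obtain ⟨t₁, ht₁, ht₁r⟩ := exists_between ht₀r
  obtain ⟨δ, hδ, hδfree⟩ := hfree t₁ ht₁r
  obtain ⟨f, hf, hev⟩ := (hfree t₁ ht₁r).polarFlatAt ⟨ht₀0, ht₁⟩
  set z₀ : ℂ := t₀ * unitVec ψ₀ with hz₀
  have hf0 : flow e t₀ ψ₀ = f z₀ := hev.self_of_nhds
  obtain ⟨w, hw, hgw⟩ := hg.surj (flow e t₀ ψ₀) (by linarith)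
  have hwn : ‖w‖ < ρ / 8 := by rwa [← hgw, hg.dist_zero hw] at hdist
  obtain ⟨M, hM⟩ := hf.exists_eq_comp (hg.flatAt hw) (by rw [← hf0, hgw])
  -- the continuation of the sector
  set G : ℝ → ℝ → D := fun t ψ => g (w + M (t * unitVec ψ - z₀)) with hG
  have hevG : ∀ᶠ x : ℝ × ℝ in 𝓝 (t₀, ψ₀), flow e x.1 x.2 = G x.1 x.2 := by
    have hc : Tendsto (fun x : ℝ × ℝ => (x.1 : ℂ) * unitVec x.2 - z₀) (𝓝 (t₀, ψ₀)) (𝓝 0) := by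
      have : Continuous fun x : ℝ × ℝ => (x.1 : ℂ) * unitVec x.2 - z₀ :=
        ((Complex.continuous_ofReal.comp continuous_fst).mul
          (continuous_unitVec.comp continuous_snd)).sub continuous_const
      simpa [hz₀] using this.tendsto (t₀, ψ₀)
    filter_upwards [hev, hc.eventually hM] with x h1 h2
    rw [add_sub_cancel] at h2
    rw [h1, h2]
  obtain ⟨η₀, hη₀, hbox⟩ := Metric.eventually_nhds_iff.1 hevG
  obtain ⟨η, hη, hηmin⟩ : ∃ η > 0, η < min (min η₀ δ) (min (min t₀ (t₁ - t₀))
      (min (ρ / 8) (ρ / 8 / t₀))) :=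
    exists_between (lt_min (lt_min hη₀ hδ) (lt_min (lt_min ht₀0 (by linarith))
      (lt_min (by positivity) (by positivity))))
  simp only [lt_min_iff] at hηmin
  obtain ⟨⟨hηη₀, hηδ⟩, ⟨hηt₀, hηt₁⟩, hηρ, hηρ'⟩ := hηmin
  rw [lt_div_iff₀ ht₀0] at hηρ'
  have hboxG : ∀ t ψ, |t - t₀| < η → |ψ - ψ₀| < η → flow e t ψ = G t ψ := fun t ψ h1 h2 =>
    hbox (y := (t, ψ)) (by
      rw [Prod.dist_eq, max_lt_iff, Real.dist_eq, Real.dist_eq]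
      exact ⟨h1.trans hηη₀, h2.trans hηη₀⟩)
  have hnorm : ∀ t ψ, t ∈ Ioo (t₀ - η) (t₀ + ρ / 4) → |ψ - ψ₀| < η →
      ‖w + M (t * unitVec ψ - z₀)‖ < ρ := by
    intro t ψ ht hψ
    have h1 : (t : ℂ) * unitVec ψ - z₀ =
        ((t - t₀ : ℝ) : ℂ) * unitVec ψ + (t₀ * unitVec ψ - t₀ * unitVec ψ₀) := by
      rw [hz₀]; push_cast; ring
    have h2 : ‖((t - t₀ : ℝ) : ℂ) * unitVec ψ‖ < ρ / 4 := by
      rw [norm_mul, norm_unitVec, mul_one, Complex.norm_real, Real.norm_eq_abs, abs_lt]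
      constructor <;> linarith [ht.1, ht.2]
    have h3 := norm_mul_unitVec_sub_le ht₀0.le ψ ψ₀
    have h4 : t₀ * |ψ - ψ₀| < ρ / 8 := by nlinarith
    have h5 := norm_add_le w (M (t * unitVec ψ - z₀))
    rw [M.norm_map, h1] at h5
    have h6 := norm_add_le (((t - t₀ : ℝ) : ℂ) * unitVec ψ)
      (t₀ * unitVec ψ - t₀ * unitVec ψ₀)
    rw [h1]; linarith
  have hflatG : ∀ t ψ, t ∈ Ioo (t₀ - η) (t₀ + ρ / 4) → |ψ - ψ₀| < η → PolarFlatAt G t ψ :=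
    fun t ψ ht hψ => ⟨_, (hg.flatAt (hnorm t ψ ht hψ)).comp_motion,
      Eventually.of_forall fun _ => rfl⟩
  -- The old sector is used before `t₀` and `G` afterwards; they agree in a whole neighbourhood of
  -- `t₀`, so the joined curves are motions there.
  have hray : ∀ ψ, |ψ - ψ₀| < η →
      IsRay e ψ (t₀ + ρ / 4) fun t => if t < t₀ then flow e t ψ else G t ψ := by
    intro ψ hψ
    obtain ⟨hst, hfl⟩ := hδfree ψ (hψ.trans hηδ)
    refine ⟨?_, fun t ht => ?_⟩
    · filter_upwards [hst, Ico_mem_nhdsGE ht₀0] with s h1 h2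
      rw [if_pos h2.2, h1]
    · rcases lt_or_ge t t₀ with h | h
      · refine (hfl t ⟨ht.1, h.trans ht₁⟩).flatMotionAt.congr ?_
        filter_upwards [Iio_mem_nhds h] with s hs
        exact if_pos hs
      · refine (hflatG t ψ ⟨by linarith, ht.2⟩ hψ).flatMotionAt.congr ?_
        filter_upwards [Ioi_mem_nhds (show t₀ - η < t by linarith)] with s hs
        split_ifs with hs'
        · exact hboxG s ψ (by rw [abs_lt]; constructor <;> linarith [mem_Ioi.1 hs]) hψ
        · rfl
  have hflowG : ∀ t ψ, t ∈ Ioo (t₀ - η) (t₀ + ρ / 4) → |ψ - ψ₀| < η → flow e t ψ = G t ψ := by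
    intro t ψ ht hψ
    rcases lt_or_ge t t₀ with h | h
    · exact hboxG t ψ (by rw [abs_lt]; constructor <;> linarith [ht.1]) hψ
    · rw [(hray ψ hψ).flow_eq (by linarith) ht.2, if_neg (not_lt.2 h)]
  refine ⟨t₀ + ρ / 4, by linarith, η, hη, fun ψ hψ => ⟨(hδfree ψ (hψ.trans hηδ)).1, fun t ht => ?_⟩⟩
  rcases lt_or_ge t t₁ with h | h
  · exact (hδfree ψ (hψ.trans hηδ)).2 t ⟨ht.1, h⟩
  · have ht' : t ∈ Ioo (t₀ - η) (t₀ + ρ / 4) := ⟨by linarith, ht.2⟩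
    refine (hflatG t ψ ht' hψ).congr ?_
    have hψ' : ψ ∈ Metric.ball ψ₀ η := by rwa [Metric.mem_ball, Real.dist_eq]
    filter_upwards [prod_mem_nhds (isOpen_Ioo.mem_nhds ht') (Metric.isOpen_ball.mem_nhds hψ')]
      with x hx
    exact hflowG _ _ hx.1 (by simpa [Real.dist_eq] using hx.2)

/-- A trajectory goes on for ever, or ends at a singular point. -/
lemma isFree_or_tendsto_singular [CompleteSpace D] {ψ ρ : ℝ} (hρ : 0 < ρ) (h : IsFree e ψ ρ) :
    (∀ r, IsFree e ψ r) ∨ ∃ τ > 0, (∀ r < τ, IsFree e ψ r) ∧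
      ∃ x, IsSingularPoint x ∧ Tendsto (fun t => flow e t ψ) (𝓝[<] τ) (𝓝 x) := by
  by_cases hall : ∀ r, IsFree e ψ r
  · exact Or.inl hall
  right
  push Not at hall
  obtain ⟨R, hR⟩ := hall
  set S := {r | IsFree e ψ r} with hS
  have hbdd : BddAbove S := ⟨R, fun r hr => by
    by_contra hlt; exact hR (IsFree.mono hr (not_le.1 hlt).le)⟩
  have hτ : 0 < sSup S := hρ.trans_le (le_csSup hbdd h)
  have hfree : ∀ r < sSup S, IsFree e ψ r := fun r hr => by
    obtain ⟨r', hr', hlt⟩ := exists_lt_of_lt_csSup ⟨ρ, h⟩ hr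
    exact hr'.mono hlt.le
  obtain ⟨x, hx⟩ : ∃ x, Tendsto (fun t => flow e t ψ) (𝓝[<] (sSup S)) (𝓝 x) := by
    -- Unit speed makes the trajectory 1-Lipschitz, so it converges at the end of its lifetime.
    have hlip : LipschitzOnWith 1 (fun t => flow e t ψ) (Ioo 0 (sSup S)) := by
      refine LipschitzOnWith.of_dist_le_mul fun a ha b hb => ?_
      have key : ∀ a ∈ Ioo 0 (sSup S), ∀ b ∈ Ioo 0 (sSup S), a ≤ b →
          dist (flow e a ψ) (flow e b ψ) ≤ 1 * (b - a) := fun a ha b hb hab =>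
        dist_le_of_locally_lipschitz (h := fun t => flow e t ψ) hab fun t ht => by
          obtain ⟨r, hr1, hr2⟩ := exists_between hb.2
          exact ((hfree r hr2).polarFlatAt
            ⟨ha.1.trans_le ht.1, ht.2.trans_lt hr1⟩).flatMotionAt.exists_lipschitz
      rw [Real.dist_eq]
      rcases le_total a b with hab | hab
      · rw [abs_sub_comm, abs_of_nonneg (by linarith)]; exact key a ha b hb hab
      · rw [abs_of_nonneg (by linarith), dist_comm]; exact key b hb a ha hab
    have hc : Cauchy (map (fun t => flow e t ψ) (𝓝[<] (sSup S))) := by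
      rw [← nhdsWithin_Ioo_eq_nhdsLT hτ]
      have : (𝓝[Ioo 0 (sSup S)] (sSup S)).NeBot := by
        rw [nhdsWithin_Ioo_eq_nhdsLT hτ]; infer_instance
      exact (cauchy_nhds.mono nhdsWithin_le_nhds).map_of_le hlip.uniformContinuousOn inf_le_right
    exact cauchy_map_iff_exists_tendsto.1 hc
  refine ⟨sSup S, hτ, hfree, x, ?_, hx⟩
  by_contra hsing
  obtain ⟨r', hr', hfr⟩ := exists_isFree_of_tendsto hτ hfree hsing hx
  exact absurd (le_csSup hbdd hfr) (not_le.2 hr')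

end Flow

/-! ### Lifetimes and the separation of directions -/

section Lifetime

variable {D : Type*} [MetricSpace D] {e : ℝ → ℝ → D}

/-- The time until which the trajectory in the direction `ψ` is defined. -/
noncomputable def lifetime (e : ℝ → ℝ → D) (ψ : ℝ) : EReal :=
  ⨆ (r : ℝ) (_ : IsFree e ψ r), (r : EReal)

lemma IsFree.le_lifetime {ψ r : ℝ} (h : IsFree e ψ r) : (r : EReal) ≤ lifetime e ψ :=
  le_iSup₂ (f := fun (r : ℝ) (_ : IsFree e ψ r) => (r : EReal)) r h

lemma lt_lifetime_iff {ψ : ℝ} {a : EReal} :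
    a < lifetime e ψ ↔ ∃ r : ℝ, IsFree e ψ r ∧ a < r := by
  simp [lifetime, lt_iSup_iff]

lemma isFree_of_lt_lifetime {ψ r : ℝ} (h : (r : EReal) < lifetime e ψ) : IsFree e ψ r := by
  obtain ⟨r', h1, h2⟩ := lt_lifetime_iff.1 h
  exact h1.mono (EReal.coe_lt_coe_iff.1 h2).le

/-- Freeness until a given time is an open condition on the direction. Semicontinuity yields a
direction of least lifetime in a compact interval. -/
lemma lowerSemicontinuous_lifetime : LowerSemicontinuous (lifetime e) := by
  intro ψ a ha
  obtain ⟨r, h1, h2⟩ := lt_lifetime_iff.1 ha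
  filter_upwards [h1.eventually] with φ hφ
  exact lt_lifetime_iff.2 ⟨r, hφ, h2⟩

lemma lifetime_eq_top {ψ : ℝ} (h : ∀ r, IsFree e ψ r) : lifetime e ψ = ⊤ :=
  EReal.eq_top_iff_forall_lt _ |>.2 fun r =>
    (EReal.coe_lt_coe_iff.2 (lt_add_one r)).trans_le (h (r + 1)).le_lifetime

/-- A trajectory of finite lifetime ends at a singular point. -/
lemma lifetime_eq_top_or [CompleteSpace D] {p : D} {θ ρ : ℝ} (h : IsConeOrSectorChart p θ ρ e)
    {ψ : ℝ} (hψ : ψ ∈ Ioo 0 θ) :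
    lifetime e ψ = ⊤ ∨ ∃ τ : ℝ, 0 < τ ∧ lifetime e ψ = τ ∧
      ∃ x, IsSingularPoint x ∧ Tendsto (fun t => flow e t ψ) (𝓝[<] τ) (𝓝 x) := by
  rcases isFree_or_tendsto_singular h.radius_pos (h.isFree hψ) with
    hall | ⟨τ, hτ, hfree, x, hx, hlim⟩
  · exact Or.inl (lifetime_eq_top hall)
  · refine Or.inr ⟨τ, hτ, le_antisymm ?_ ?_, x, hx, hlim⟩
    -- Beyond `τ` the flow would pass continuously through `x` at a flat point, although `x` is
    -- singular.
    · by_contra hlt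
      have hf := isFree_of_lt_lifetime (not_le.1 hlt)
      obtain ⟨r, h1, h2⟩ := lt_lifetime_iff.1 (not_le.1 hlt)
      have hm := (h1.polarFlatAt ⟨hτ, EReal.coe_lt_coe_iff.1 h2⟩).flatMotionAt
      have := tendsto_nhds_unique hlim (hm.continuousAt.tendsto.mono_left nhdsWithin_le_nhds)
      exact hm.not_isSingularPoint (this ▸ hx)
    · refine le_of_forall_lt fun a ha => ?_
      obtain ⟨r, h1, h2⟩ := EReal.lt_iff_exists_real_btwn.1 ha
      exact h1.trans_le (hfree r (EReal.coe_lt_coe_iff.1 h2)).le_lifetime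

/-- On a circular arc a flat map is Lipschitz with the radius as constant. -/
lemma dist_polar_le {Φ : ℝ → ℝ → D} {t a b : ℝ} (ht : 0 ≤ t)
    (h : ∀ ψ ∈ uIcc a b, PolarFlatAt Φ t ψ) : dist (Φ t a) (Φ t b) ≤ t * |a - b| := by
  wlog hab : a ≤ b generalizing a b
  · rw [dist_comm, abs_sub_comm]
    exact this (by rwa [uIcc_comm]) (not_le.1 hab).le
  rw [abs_sub_comm, abs_of_nonneg (by linarith)]
  rw [uIcc_of_le hab] at h
  refine dist_le_of_locally_lipschitz hab fun ψ hψ => ?_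
  obtain ⟨f, hf, hev⟩ := h ψ hψ
  obtain ⟨δ, hδ, hl⟩ := hf.exists_lipschitz
  have c1 : Tendsto (fun φ : ℝ => (t, φ)) (𝓝 ψ) (𝓝 (t, ψ)) :=
    (Continuous.prodMk_right t).tendsto ψ
  have c2 : Tendsto (fun φ : ℝ => ‖t * unitVec φ - t * unitVec ψ‖) (𝓝 ψ) (𝓝 0) := by
    have : Continuous fun φ : ℝ => ‖t * unitVec φ - t * unitVec ψ‖ :=
      ((continuous_const.mul continuous_unitVec).sub continuous_const).norm
    simpa using this.tendsto ψ
  obtain ⟨δ', hδ', hb⟩ := Metric.eventually_nhds_iff.1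
    ((c1.eventually hev).and (c2.eventually (gt_mem_nhds hδ)))
  refine ⟨δ', hδ', fun y y' hy hy' => ?_⟩
  obtain ⟨e1, n1⟩ := hb (y := y) (by rwa [Real.dist_eq])
  obtain ⟨e2, n2⟩ := hb (y := y') (by rwa [Real.dist_eq])
  simp only at e1 e2
  rw [e1, e2]
  exact (hl _ _ n1 n2).trans (norm_mul_unitVec_sub_le ht y y')

/-- A direction in which the trajectory stays away from the singular points is separated from the
directions in which a singular point is reached soon. -/
lemma le_mul_abs_sub_of_lifetime_le [CompleteSpace D] {p : D} {θ ρ : ℝ}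
    (h : IsConeOrSectorChart p θ ρ e) {ψ w ε ℓ : ℝ} (hψ : ψ ∈ Ioo 0 θ) (hw : w ∈ Ioo 0 θ)
    (hfar : ∀ t > 0, ∀ x, IsSingularPoint x → ε ≤ dist (flow e t ψ) x)
    (hℓ : lifetime e w ≤ ℓ) : ε ≤ ℓ * |ψ - w| := by
  have hsub : uIcc w ψ ⊆ Ioo 0 θ := (convex_Ioo 0 θ).ordConnected.uIcc_subset hw hψ
  -- `w` itself may not bound a flat sector with `ψ`, since a direction between them may end
  -- earlier; `φ`, of least lifetime, does.
  obtain ⟨φ, hφ, hmin⟩ := (lowerSemicontinuous_lifetime (e := e)).lowerSemicontinuousOn (uIcc w ψ)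
    |>.exists_isMinOn nonempty_uIcc isCompact_uIcc
  have hφℓ : lifetime e φ ≤ ℓ := (hmin left_mem_uIcc).trans hℓ
  rcases lifetime_eq_top_or h (hsub hφ) with htop | ⟨τ, hτ, hlife, x, hx, hlim⟩
  · rw [htop] at hφℓ; exact absurd hφℓ (not_le.2 (EReal.coe_lt_top ℓ))
  have hτℓ : τ ≤ ℓ := by rw [hlife] at hφℓ; exact EReal.coe_le_coe_iff.1 hφℓ
  have hlim' : Tendsto (fun t => dist (flow e t φ) x + ℓ * |ψ - w|) (𝓝[<] τ)
      (𝓝 (0 + ℓ * |ψ - w|)) := by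
    refine Tendsto.add_const _ ?_
    simpa using hlim.dist (tendsto_const_nhds (x := x))
  rw [zero_add] at hlim'
  refine ge_of_tendsto hlim' ?_
  filter_upwards [Ioo_mem_nhdsLT hτ] with t ht
  have h1 : dist (flow e t ψ) (flow e t φ) ≤ t * |ψ - φ| := by
    refine dist_polar_le ht.1.le fun φ' hφ' => ?_
    have hmem : φ' ∈ uIcc w ψ := uIcc_subset_uIcc right_mem_uIcc hφ hφ'
    obtain ⟨r, hr1, hr2⟩ := exists_between ht.2
    refine IsFree.polarFlatAt (r := r) (isFree_of_lt_lifetime ?_) ⟨ht.1, hr1⟩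
    refine (EReal.coe_lt_coe_iff.2 hr2).trans_le ?_
    rw [← hlife]; exact hmin hmem
  have h2 : |ψ - φ| ≤ |ψ - w| := abs_sub_right_of_mem_uIcc hφ
  have h3 : t * |ψ - φ| ≤ ℓ * |ψ - w| :=
    mul_le_mul (ht.2.le.trans hτℓ) h2 (abs_nonneg _) (hτ.le.trans hτℓ)
  have h4 := hfar t ht.1 x hx
  linarith [dist_triangle (flow e t ψ) (flow e t φ) x]

end Lifetime

/-! ### Large immersed flat disks -/

section FlatBall

variable {D : Type*} [MetricSpace D]

/-- `p` is the centre of an immersed flat disk of radius `R`. -/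
def HasFlatBall (p : D) (R : ℝ) : Prop :=
  ∃ f : ℂ → D, f 0 = p ∧ ∀ z, ‖z‖ < R → FlatAt f z

lemma HasFlatBall.mono {p : D} {R R' : ℝ} (h : HasFlatBall p R) (hR : R' ≤ R) :
    HasFlatBall p R' := by
  obtain ⟨f, h0, hf⟩ := h
  exact ⟨f, h0, fun z hz => hf z (hz.trans_le hR)⟩

/-- Immersed flat disks can be recentred inside a folded chart. -/
lemma IsFoldedChart.hasFlatBall {κ : ℂ → ℂ} {ρ R : ℝ} {g : ℂ → D} (hg : IsFoldedChart κ ρ g)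
    {y y' : D} (hy : dist y (g 0) < ρ) (hy' : dist y' (g 0) < ρ) (hR : 2 * ρ < R)
    (h : HasFlatBall y R) : HasFlatBall y' (R - 2 * ρ) := by
  have hρ := hg.pos
  obtain ⟨f, rfl, hf⟩ := h
  obtain ⟨w, hw, hgw⟩ := hg.surj _ hy
  obtain ⟨w', hw', rfl⟩ := hg.surj _ hy'
  obtain ⟨M, hM⟩ := (hf 0 (by simpa using by linarith)).exists_eq_comp (hg.flatAt hw) hgw.symm
  obtain ⟨δ, hδ, hM⟩ := Metric.eventually_nhds_iff.1 hM
  set z := M.symm (w' - w) with hz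
  have hzn : ‖z‖ < 2 * ρ := by
    rw [hz, M.symm.norm_map]; linarith [norm_sub_le w' w]
  have hfz : f z = g w' := by
    by_cases hz0 : z = 0
    · have : w' = w := by
        rw [hz, map_eq_zero_iff _ M.symm.injective, sub_eq_zero] at hz0; exact hz0
      rw [hz0, this, hgw]
    have hzp : 0 < ‖z‖ := norm_pos_iff.2 hz0
    set v := z / ‖z‖ with hv
    have hvn : ‖v‖ = 1 := by rw [hv]; simp [hz0]
    have hzv : (‖z‖ : ℂ) * v = z := by
      have : (‖z‖ : ℂ) ≠ 0 := by exact_mod_cast hzp.ne'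
      rw [hv, mul_div_cancel₀ _ this]
    have hMs : ∀ s : ℝ, M (s * v) = s * M v := fun s => by
      rw [← Complex.real_smul, map_smul, Complex.real_smul]
    have hns : ∀ s : ℝ, 0 ≤ s → ‖(s : ℂ) * v‖ = s := fun s hs => by simp [hvn, abs_of_nonneg hs]
    have hzw : w + (‖z‖ : ℂ) * M v = w' := by
      rw [← hMs, hzv, hz, M.apply_symm_apply, add_sub_cancel]
    -- The maps `f` and `g` are matched by `M` only near the start; uniqueness of motion carries the
    -- match along the segment from `w` to `w'`.
    have := FlatMotionAt.eq_of_eqOn (γ := fun s : ℝ => f (0 + s * v))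
      (γ' := fun s : ℝ => g (w + s * M v)) (a := 0) (c := δ) (t₀ := ‖z‖) hδ hzp ?_ ?_ ?_
    · simpa [hzv, hzw] using this
    · intro t ht
      refine FlatAt.flatMotionAt hvn (hf _ ?_)
      rw [zero_add, hns t ht.1.le]; linarith [ht.2]
    · intro t ht
      refine FlatAt.flatMotionAt (by rw [M.norm_map, hvn]) (hg.flatAt ?_)
      have hconv := (convex_ball (0 : ℂ) ρ).add_smul_sub_mem (x := w) (y := w')
        (by simpa using hw) (by simpa using hw') (t := t / ‖z‖)
        ⟨by have := ht.1; positivity, (div_le_one hzp).2 ht.2⟩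
      have he : (t / ‖z‖) • (w' - w) = (t : ℂ) * M v := by
        rw [← hzw, add_sub_cancel_left, Complex.real_smul]
        have : (‖z‖ : ℂ) ≠ 0 := by exact_mod_cast hzp.ne'
        push_cast; field_simp
      rw [he] at hconv
      simpa using hconv
    · intro t ht
      have := hM (y := (t : ℂ) * v) (by
        rw [dist_zero_right, hns t ht.1.le]; exact ht.2)
      rw [hMs] at this
      exact this
  refine ⟨fun x => f (z + x), by simpa using hfz, fun x hx => (hf _ ?_).comp_add⟩
  linarith [norm_add_le z x]

/-- The centre of a chart which meets a large immersed flat disk is nonsingular. -/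
lemma IsConeOrSectorChart.not_isSingularPoint {p y : D} {θ ρ R : ℝ} {e : ℝ → ℝ → D}
    (h : IsConeOrSectorChart p θ ρ e) (hy : dist y p < ρ) (hR : 2 * ρ < R)
    (hflat : HasFlatBall y R) : ¬ IsSingularPoint p := by
  have hρ := h.radius_pos
  obtain ⟨f, rfl, hf⟩ := hflat
  obtain ⟨ε, hε, hfill⟩ := (hf 0 (by simpa using by linarith)).exists_ball_subset hρ
  -- `y` may be the centre or lie on a boundary ray, where flatness of `e` is not available, so a
  -- nearby point replaces it.
  obtain ⟨r, hr, ψ, hψ, hd⟩ := h.exists_dist_lt hy hε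
  obtain ⟨z, hz, hfz, hze⟩ := hfill _ hd
  rw [sub_zero] at hz
  obtain ⟨E, hE, hev⟩ := h.polarFlatAt hr hψ
  have hE0 : e r ψ = E (r * unitVec ψ) := hev.self_of_nhds
  obtain ⟨M, hM⟩ := hE.exists_eq_comp hfz (by rw [← hE0, hze])
  set v := M (-unitVec ψ) with hv
  have hvn : ‖v‖ = 1 := by rw [hv, M.norm_map, norm_neg, norm_unitVec]
  have hMs : ∀ s : ℝ, M (s * -unitVec ψ) = s * v := fun s => by
    rw [← Complex.real_smul, map_smul, Complex.real_smul]
  have hnear : ∀ᶠ s : ℝ in 𝓝 0, e (r - s) ψ = f (z + s * v) := by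
    have c1 : Tendsto (fun s : ℝ => (r - s, ψ)) (𝓝 0) (𝓝 (r, ψ)) := by
      have : Continuous fun s : ℝ => (r - s, ψ) := by fun_prop
      simpa using this.tendsto 0
    have c2 : Tendsto (fun s : ℝ => (s : ℂ) * -unitVec ψ) (𝓝 0) (𝓝 0) := by
      have : Continuous fun s : ℝ => (s : ℂ) * -unitVec ψ := by fun_prop
      simpa using this.tendsto 0
    filter_upwards [c1.eventually hev, c2.eventually hM] with s h1 h2
    rw [hMs] at h2
    rw [h1, ← h2]; congr 1; push_cast; ring
  obtain ⟨δ, hδ, hnear⟩ := Metric.eventually_nhds_iff.1 hnear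
  -- As `‖z‖ < ρ` and `r < ρ`, the radius towards `p` lifts to a segment in the flat disk of radius
  -- `R > 2 * ρ`. Its endpoint is a flat point of `f` over `p`.
  have hflat : ∀ s : ℝ, 0 ≤ s → s ≤ r → FlatAt f (z + s * v) := fun s h1 h2 => hf _ (by
    have h3 := norm_add_le z (s * v)
    rw [norm_mul, hvn, mul_one, Complex.norm_real, Real.norm_of_nonneg h1] at h3
    linarith [hr.2])
  have heq : ∀ s ∈ Ioo 0 r, e (r - s) ψ = f (z + s * v) := by
    intro s hs
    refine FlatMotionAt.eq_of_eqOn (γ := fun s => e (r - s) ψ) (γ' := fun s : ℝ => f (z + s * v))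
      (a := 0) (c := δ) (t₀ := s) hδ hs.1 (fun t ht => ?_) (fun t ht => ?_) (fun t ht => ?_)
    · have h1 : r - t ∈ Ioo 0 ρ := ⟨by linarith [ht.2, hs.2], by linarith [ht.1, hr.2]⟩
      exact (h.polarFlatAt h1 hψ).flatMotionAt.const_sub (γ := fun t => e t ψ)
    · exact FlatAt.flatMotionAt hvn (hflat t ht.1.le (ht.2.trans hs.2.le))
    · exact hnear (by rw [Real.dist_eq, sub_zero, abs_of_pos ht.1]; exact ht.2)
  have hlim1 : Tendsto (fun s : ℝ => f (z + s * v)) (𝓝[<] r) (𝓝 (f (z + r * v))) :=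
    (FlatAt.flatMotionAt hvn (hflat r hr.1.le le_rfl)).continuousAt.tendsto.mono_left
      nhdsWithin_le_nhds
  have hlim2 : Tendsto (fun s : ℝ => f (z + s * v)) (𝓝[<] r) (𝓝 p) := by
    rw [tendsto_iff_dist_tendsto_zero]
    have h0 : Tendsto (fun s => r - s) (𝓝[<] r) (𝓝 0) := by
      have : Continuous fun s => r - s := by fun_prop
      simpa using (this.tendsto r).mono_left (nhdsWithin_le_nhds (s := Iio r))
    refine h0.congr' ?_
    filter_upwards [Ioo_mem_nhdsLT hr.1] with s hs
    rw [← heq s hs, h.dist_center ⟨by linarith [hs.2], by linarith [hs.1, hr.2]⟩ hψ]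
  rw [tendsto_nhds_unique hlim2 hlim1]
  exact (hflat r hr.1.le le_rfl).not_isSingularPoint

/-- If there are immersed flat disks of all radii, then there are no singular points. -/
lemma IsFlatDisk.not_isSingularPoint_of_hasFlatBall [CompactSpace D] [PreconnectedSpace D]
    (hD : IsFlatDisk D) (h : ∀ R, ∃ p : D, HasFlatBall p R) (x : D) : ¬ IsSingularPoint x := by
  have hstep : ∀ x : D, ∃ ρ > 0, ∀ y y', dist y x < ρ → dist y' x < ρ → ∀ R, 2 * ρ < R →
      HasFlatBall y R → HasFlatBall y' (R - 2 * ρ) := by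
    intro x
    by_cases hx : IsSingularPoint x
    · obtain ⟨θ, ρ, e, he⟩ := hD.flat x
      have he' : IsConeOrSectorChart x θ ρ e := he
      exact ⟨ρ, he'.radius_pos, fun y y' hy _ R hR hf =>
        absurd hx (he'.not_isSingularPoint hy hR hf)⟩
    · obtain ⟨g, κ, ρ, hg, rfl⟩ := exists_isFoldedChart hx
      exact ⟨ρ, hg.pos, fun y y' hy hy' R hR hf => hg.hasFlatBall hy hy' hR hf⟩
  choose ρ hρ hstep using hstep
  -- Recentring costs only `2 * ρ x`, harmless when all radii are available. So each ball of radius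
  -- `ρ x` lies in `G` or misses it, and `G` is clopen; a limit of centres of growing disks shows
  -- that it is nonempty.
  set G := {p : D | ∀ R, HasFlatBall p R} with hG
  have hball : ∀ x y y', dist y x < ρ x → dist y' x < ρ x → y ∈ G → y' ∈ G := by
    intro x y y' hy hy' hyG R
    refine (hstep x y y' hy hy' (max R 0 + 2 * ρ x + 1) (by linarith [le_max_right R 0])
      (hyG _)).mono ?_
    linarith [le_max_left R 0]
  have hopen : IsOpen G := Metric.isOpen_iff.2 fun x hx =>
    ⟨ρ x, hρ x, fun y hy => hball x x y (by simpa using hρ x) hy hx⟩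
  have hclosed : IsClosed G := by
    refine isClosed_of_closure_subset fun x hx => ?_
    obtain ⟨y, hy, hd⟩ := Metric.mem_closure_iff.1 hx (ρ x) (hρ x)
    exact hball x y x (by rwa [dist_comm]) (by simpa using hρ x) hy
  have hne : G.Nonempty := by
    choose p hp using fun n : ℕ => h n
    obtain ⟨x, -, φ, hφ, hlim⟩ := isCompact_univ.tendsto_subseq fun n => mem_univ (p n)
    refine ⟨x, fun R => ?_⟩
    have e1 : ∀ᶠ n in atTop, dist (p (φ n)) x < ρ x :=
      hlim.eventually (Metric.ball_mem_nhds x (hρ x))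
    obtain ⟨N, hN⟩ := exists_nat_gt (max R 0 + 2 * ρ x)
    obtain ⟨n, h1, h2⟩ := (e1.and (eventually_ge_atTop N)).exists
    have h3 : (N : ℝ) ≤ φ n := by exact_mod_cast h2.trans (hφ.id_le n)
    refine (hstep x _ x h1 (by simpa using hρ x) (φ n) (by linarith [le_max_right R 0])
      (hp (φ n))).mono ?_
    linarith [le_max_left R 0]
  have huniv : G = univ := IsClopen.eq_univ ⟨hclosed, hopen⟩ hne
  have hx : x ∈ G := huniv ▸ mem_univ x
  obtain ⟨f, rfl, hf⟩ := hx 1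
  exact (hf 0 (by simp)).not_isSingularPoint

end FlatBall

/-! ### Developing maps and the existence of a singular point -/

section Developing

variable {D : Type*} [MetricSpace D]

/-- Every point of `V` has a neighbourhood on which `g` is an isometric embedding. -/
def IsDevelopingOn (g : D → ℂ) (V : Set D) : Prop :=
  ∀ p ∈ V, ∃ r > 0, ∀ y y', dist y p < r → dist y' p < r → dist (g y) (g y') = dist y y'

lemma IsDevelopingOn.mono {g : D → ℂ} {V W : Set D} (h : IsDevelopingOn g W) (hVW : V ⊆ W) :
    IsDevelopingOn g V := fun p hp => h p (hVW hp)

lemma IsDevelopingOn.congr {g g' : D → ℂ} {V : Set D} (hV : IsOpen V) (h : IsDevelopingOn g V)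
    (he : ∀ y ∈ V, g' y = g y) : IsDevelopingOn g' V := by
  intro p hp
  obtain ⟨r, hr, hd⟩ := h p hp
  obtain ⟨s, hs, hball⟩ := Metric.isOpen_iff.1 hV p hp
  refine ⟨min r s, lt_min hr hs, fun y y' hy hy' => ?_⟩
  rw [he y (hball (hy.trans_le (min_le_right _ _))),
    he y' (hball (hy'.trans_le (min_le_right _ _))),
    hd y y' (hy.trans_le (min_le_left _ _)) (hy'.trans_le (min_le_left _ _))]

lemma IsDevelopingOn.motion {g : D → ℂ} {V : Set D} (h : IsDevelopingOn g V) (c : ℂ)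
    (M : ℂ ≃ₗᵢ[ℝ] ℂ) : IsDevelopingOn (fun y => c + M (g y)) V := by
  intro p hp
  obtain ⟨r, hr, hd⟩ := h p hp
  exact ⟨r, hr, fun y y' hy hy' => by rw [dist_add_left, M.dist_map, hd y y' hy hy']⟩

lemma IsDevelopingOn.union {g : D → ℂ} {V W : Set D} (hV : IsDevelopingOn g V)
    (hW : IsDevelopingOn g W) : IsDevelopingOn g (V ∪ W) :=
  fun p hp => hp.elim (hV p) (hW p)

lemma IsFoldedChart.exists_isDevelopingOn {κ : ℂ → ℂ} {ρ : ℝ} {G : ℂ → D}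
    (h : IsFoldedChart κ ρ G) : ∃ g : D → ℂ, IsDevelopingOn g (Metric.ball (G 0) ρ) := by
  have hex : ∀ y, ∃ w, dist y (G 0) < ρ → ‖w‖ < ρ ∧ G w = y := fun y => by
    by_cases hy : dist y (G 0) < ρ
    · obtain ⟨w, hw⟩ := h.surj y hy
      exact ⟨w, fun _ => hw⟩
    · exact ⟨0, fun h => absurd h hy⟩
  choose k hk using hex
  refine ⟨fun y => κ (k y), fun p hp => ?_⟩
  obtain ⟨r, hr, hball⟩ := Metric.isOpen_iff.1 Metric.isOpen_ball p hp
  refine ⟨r, hr, fun y y' hy hy' => ?_⟩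
  obtain ⟨h1, h2⟩ := hk y (hball hy)
  obtain ⟨h3, h4⟩ := hk y' (hball hy')
  conv_rhs => rw [← h2, ← h4, h.dist_eq _ _ h1 h3]
  rw [dist_eq_norm]

lemma isDevelopingOn_singleton_iff {g : D → ℂ} {p : D} : IsDevelopingOn g {p} ↔
    ∃ r > 0, ∀ y y', dist y p < r → dist y' p < r → dist (g y) (g y') = dist y y' := by
  simp [IsDevelopingOn]

/-- In a folded chart a developing map is a motion of the plane. -/
lemma IsFoldedChart.exists_eq_motion {κ : ℂ → ℂ} {ρ : ℝ} {G : ℂ → D} (h : IsFoldedChart κ ρ G)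
    {g : D → ℂ} (hg : IsDevelopingOn g {G 0}) :
    ∃ r > 0, r ≤ ρ ∧ ∃ L : ℂ ≃ₗᵢ[ℝ] ℂ, ∀ w, ‖w‖ < r → g (G w) = g (G 0) + L (κ w) := by
  obtain ⟨r, hr, hd⟩ := isDevelopingOn_singleton_iff.1 hg
  set s := min r ρ with hs
  have hspos : 0 < s := lt_min hr h.pos
  have hdist : ∀ w w', ‖w‖ < s → ‖w'‖ < s → dist (g (G w)) (g (G w')) = ‖κ w - κ w'‖ := by
    intro w w' hw hw'
    have h1 := hw.trans_le (min_le_right _ _)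
    have h2 := hw'.trans_le (min_le_right _ _)
    rw [hd _ _ (by rw [h.dist_zero h1]; exact hw.trans_le (min_le_left _ _))
      (by rw [h.dist_zero h2]; exact hw'.trans_le (min_le_left _ _)), h.dist_eq _ _ h1 h2]
  have hhalf : ‖((s / 2 : ℝ) : ℂ)‖ < s := by
    rw [Complex.norm_real, Real.norm_of_nonneg (by positivity)]; linarith
  have hm := h.model
  obtain ⟨L, hL⟩ := exists_linearIsometryEquiv_eqOn (k := fun w => g (G w) - g (G 0))
    (Q := {w | ‖w‖ < s ∧ κ w = w}) (s := s / 2) (by positivity)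
    ⟨by simpa using hspos, hm.map_zero⟩ ⟨hhalf, hm.eq_self (by simp)⟩
    ⟨by rw [norm_mul, Complex.norm_I, mul_one]; exact hhalf,
      hm.eq_self (by simp; positivity)⟩ (by simp)
    (by
      rintro a ⟨ha, hka⟩ b ⟨hb, hkb⟩
      rw [sub_sub_sub_cancel_right, ← dist_eq_norm, hdist a b ha hb, hka, hkb])
  refine ⟨s, hspos, min_le_right _ _, L, fun w hw => ?_⟩
  rw [← hL (κ w) ⟨by rwa [hm.norm_map], hm.idem w⟩,
    h.apply_model (hw.trans_le (min_le_right _ _)), add_sub_cancel]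

lemma linearIsometryEquiv_eq_of_eq {M M' : ℂ ≃ₗᵢ[ℝ] ℂ} {s : ℝ} (hs : s ≠ 0) (h1 : M s = M' s)
    (hI : M (s * Complex.I) = M' (s * Complex.I)) : M = M' := by
  have hmul : ∀ (N : ℂ ≃ₗᵢ[ℝ] ℂ) (t : ℝ) (x : ℂ), N (t * x) = t * N x := fun N t x => by
    rw [← Complex.real_smul, map_smul, Complex.real_smul]
  have hs' : (s : ℂ) ≠ 0 := by exact_mod_cast hs
  have e1 : M 1 = M' 1 := by
    rw [← mul_one (s : ℂ), hmul, hmul] at h1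
    exact mul_left_cancel₀ hs' h1
  have e2 : M Complex.I = M' Complex.I := by
    rw [hmul, hmul] at hI
    exact mul_left_cancel₀ hs' hI
  ext z
  have hz : z = z.re * 1 + z.im * Complex.I := by simp
  rw [hz, map_add, map_add, hmul, hmul, hmul, hmul, e1, e2]

/-- Two developing maps differ locally by a motion of the plane. -/
lemma exists_eventually_eq_motion (hns : ∀ x : D, ¬ IsSingularPoint x)
    {g g' : D → ℂ} {p : D} (hg : IsDevelopingOn g {p})
    (hg' : IsDevelopingOn g' {p}) :
    ∃ (c : ℂ) (M : ℂ ≃ₗᵢ[ℝ] ℂ), ∀ᶠ y in 𝓝 p, g' y = c + M (g y) := by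
  obtain ⟨G, κ, ρ, hG, rfl⟩ := exists_isFoldedChart (hns p)
  obtain ⟨r, hr, hrρ, L, hL⟩ := hG.exists_eq_motion hg
  obtain ⟨r', hr', hrρ', L', hL'⟩ := hG.exists_eq_motion hg'
  refine ⟨g' (G 0) - L' (L.symm (g (G 0))), L.symm.trans L', ?_⟩
  filter_upwards [Metric.ball_mem_nhds (G 0) (lt_min hr hr')] with y hy
  rw [Metric.mem_ball] at hy
  obtain ⟨w, hw, rfl⟩ := hG.surj y (hy.trans_le ((min_le_left _ _).trans hrρ))
  rw [hG.dist_zero hw] at hy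
  rw [hL w (hy.trans_le (min_le_left _ _)), hL' w (hy.trans_le (min_le_right _ _)),
    add_comm (g (G 0)), map_add]
  simp

/-- Even at a boundary point the image of `g` contains a half disk, hence two independent
directions, and these determine a motion. -/
lemma motion_unique (hns : ∀ x : D, ¬ IsSingularPoint x)
    {g : D → ℂ} {p : D} (hg : IsDevelopingOn g {p}) {c c' : ℂ}
    {M M' : ℂ ≃ₗᵢ[ℝ] ℂ} (h : ∀ᶠ y in 𝓝 p, c + M (g y) = c' + M' (g y)) : c = c' ∧ M = M' := by
  obtain ⟨G, κ, ρ, hG, rfl⟩ := exists_isFoldedChart (hns p)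
  obtain ⟨r, hr, hrρ, L, hL⟩ := hG.exists_eq_motion hg
  have hcont : Tendsto G (𝓝 0) (𝓝 (G 0)) := hG.flatAt_zero.continuousAt
  obtain ⟨r', hr', hb⟩ := Metric.eventually_nhds_iff.1 (hcont.eventually h)
  set s := min r r' / 2 with hs
  have hspos : 0 < s := by have := lt_min hr hr'; positivity
  have hsr : s < r := by linarith [min_le_left r r', lt_min hr hr']
  have hsr' : s < r' := by linarith [min_le_right r r', lt_min hr hr']
  have hn : ‖(s : ℂ)‖ = s := by rw [Complex.norm_real, Real.norm_of_nonneg hspos.le]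
  have key : ∀ w : ℂ, ‖w‖ = s → 0 ≤ w.im → M (L w) = M' (L w) := by
    intro w hw hi
    have h0 := h.self_of_nhds
    have h1 := hb (y := w) (by rw [dist_zero_right, hw]; exact hsr')
    rw [hL w (hw.trans_lt hsr), hG.model.eq_self hi, map_add, map_add, ← add_assoc, h0,
      ← add_assoc] at h1
    exact add_left_cancel h1
  have hM : L.trans M = L.trans M' := by
    refine linearIsometryEquiv_eq_of_eq hspos.ne' (key s hn (by simp)) (key _ ?_ ?_)
    · rw [norm_mul, Complex.norm_I, mul_one, hn]
    · simp [hspos.le]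
  have hMM : M = M' := by
    ext z
    have := congrArg (fun N : ℂ ≃ₗᵢ[ℝ] ℂ => N (L.symm z)) hM
    simpa using this
  subst hMM
  exact ⟨add_right_cancel h.self_of_nhds, rfl⟩

/-- On a connected open set two developing maps differ by a motion of the plane. -/
lemma exists_eq_motion_of_isPreconnected (hns : ∀ x : D, ¬ IsSingularPoint x)
    {g g' : D → ℂ} {U : Set D} (hU : IsPreconnected U)
    (hg : IsDevelopingOn g U) (hg' : IsDevelopingOn g' U) :
    ∃ (c : ℂ) (M : ℂ ≃ₗᵢ[ℝ] ℂ), ∀ y ∈ U, g' y = c + M (g y) := by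
  rcases U.eq_empty_or_nonempty with rfl | ⟨p, hp⟩
  · exact ⟨0, LinearIsometryEquiv.refl ℝ ℂ, by simp⟩
  have hloc : ∀ y ∈ U, ∃ (c : ℂ) (M : ℂ ≃ₗᵢ[ℝ] ℂ), ∀ᶠ x in 𝓝 y, g' x = c + M (g x) :=
    fun y hy => exists_eventually_eq_motion hns (hg.mono (singleton_subset_iff.2 hy))
      (hg'.mono (singleton_subset_iff.2 hy))
  obtain ⟨c, M, hcM⟩ := hloc p hp
  set S : Set D := {y | ∀ᶠ x in 𝓝 y, g' x = c + M (g x)} with hS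
  -- The points with a different transition motion. Since `S'` is not confined to `U`, it records
  -- that `g` is developing nearby, as `motion_unique` requires.
  set S' : Set D := {y | ∃ (c' : ℂ) (M' : ℂ ≃ₗᵢ[ℝ] ℂ), ¬ (c' = c ∧ M' = M) ∧
    ∀ᶠ x in 𝓝 y, g' x = c' + M' (g x) ∧ IsDevelopingOn g {x}} with hS'
  have hSo : IsOpen S := isOpen_setOfPred_eventually_nhds
  have hSo' : IsOpen S' := by
    refine isOpen_iff_mem_nhds.2 ?_
    rintro y ⟨c', M', hne, hy⟩
    filter_upwards [eventually_eventually_nhds.2 hy] with x hx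
    exact ⟨c', M', hne, hx⟩
  have hdisj : Disjoint S S' := by
    rw [Set.disjoint_left]
    rintro y hy ⟨c', M', hne, hy'⟩
    refine hne (motion_unique hns hy'.self_of_nhds.2 ?_)
    filter_upwards [hy, hy'] with x h1 h2
    rw [← h1, ← h2.1]
  have hcover : U ⊆ S ∪ S' := by
    intro y hy
    obtain ⟨c', M', h⟩ := hloc y hy
    by_cases hc : c' = c ∧ M' = M
    · left; rw [hc.1, hc.2] at h; exact h
    · right
      refine ⟨c', M', hc, h.and ?_⟩
      obtain ⟨r, hr, hd⟩ := hg y hy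
      filter_upwards [Metric.ball_mem_nhds y hr] with x hx
      obtain ⟨s, hs, hball⟩ := Metric.isOpen_iff.1 Metric.isOpen_ball x hx
      exact isDevelopingOn_singleton_iff.2 ⟨s, hs, fun z z' hz hz' =>
        hd z z' (hball hz) (hball hz')⟩
  have hsub : U ⊆ S := hU.subset_left_of_subset_union hSo hSo' hdisj hcover ⟨p, hp, hcM⟩
  exact ⟨c, M, fun y hy => (hsub hy : ∀ᶠ x in 𝓝 y, _).self_of_nhds⟩

/-- On the connected overlap the two maps differ by a single motion; applying it to the second map
makes them agree. -/
lemma exists_isDevelopingOn_union (hns : ∀ x : D, ¬ IsSingularPoint x)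
    {V W : Set D} (hV : IsOpen V) (hW : IsOpen W)
    (hVW : IsPreconnected (V ∩ W)) (h : ∃ g : D → ℂ, IsDevelopingOn g V)
    (h' : ∃ g : D → ℂ, IsDevelopingOn g W) : ∃ g : D → ℂ, IsDevelopingOn g (V ∪ W) := by
  classical
  obtain ⟨g, hg⟩ := h
  obtain ⟨g', hg'⟩ := h'
  obtain ⟨c, M, hcM⟩ := exists_eq_motion_of_isPreconnected hns hVW (hg'.mono inter_subset_right)
    (hg.mono inter_subset_left)
  refine ⟨fun y => if y ∈ V then g y else c + M (g' y),
    (hg.congr hV fun y hy => if_pos hy).union ((hg'.motion c M).congr hW fun y hy => ?_)⟩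
  split_ifs with hyV
  · exact hcM y ⟨hyV, hy⟩
  · rfl

/-- A flat disk without singular points has a global developing map. -/
lemma exists_isDevelopingOn_univ (hns : ∀ x : D, ¬ IsSingularPoint x)
    (φ : D ≃ₜ Metric.closedBall (0 : ℂ) 1) :
    ∃ g : D → ℂ, IsDevelopingOn g univ := by
  set f : D → ℂ := fun y => φ y with hf
  have hfc : Continuous f := by fun_prop
  have hind : IsInducing f := IsInducing.subtypeVal.comp φ.isInducing
  -- Convexity of the round disk replaces simple connectedness: overlaps of rectangles and strips
  -- have connected preimages.
  have hpre : ∀ C : Set ℂ, Convex ℝ C → IsPreconnected (f ⁻¹' C) := by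
    intro C hC
    rw [← hind.isPreconnected_image, image_preimage_eq_inter_range]
    have : range f = Metric.closedBall (0 : ℂ) 1 := by
      have : f = Subtype.val ∘ φ := rfl
      rw [this, range_comp, φ.range_coe, image_univ, Subtype.range_coe]
    rw [this]
    exact (hC.inter (convex_closedBall _ _)).isPreconnected
  have hopen : ∀ C : Set ℂ, IsOpen C → IsOpen (f ⁻¹' C) := fun C hC => hC.preimage hfc
  -- the rectangles and half strips
  have hre : ∀ a b : ℝ, IsOpen {z : ℂ | a < z.re ∧ z.re < b} ∧
      Convex ℝ {z : ℂ | a < z.re ∧ z.re < b} := fun a b =>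
    ⟨isOpen_Ioo.preimage Complex.continuous_re,
      (convex_Ioo a b).linear_preimage Complex.reLm⟩
  have him : ∀ a b : ℝ, IsOpen {z : ℂ | a < z.im ∧ z.im < b} ∧
      Convex ℝ {z : ℂ | a < z.im ∧ z.im < b} := fun a b =>
    ⟨isOpen_Ioo.preimage Complex.continuous_im,
      (convex_Ioo a b).linear_preimage Complex.imLm⟩
  have hball : ∀ y, ‖f y‖ ≤ 1 := fun y => by
    have := (φ y).2; rwa [mem_closedBall_zero_iff] at this
  have hrere : ∀ y, |(f y).re| ≤ 1 := fun y => (Complex.abs_re_le_norm _).trans (hball y)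
  have himim : ∀ y, |(f y).im| ≤ 1 := fun y => (Complex.abs_im_le_norm _).trans (hball y)
  have hrect : ∀ z : ℂ, ∃ ε > 0, ∃ g : D → ℂ, IsDevelopingOn g
      (f ⁻¹' ({w | z.re - ε < w.re ∧ w.re < z.re + ε} ∩
        {w | z.im - ε < w.im ∧ w.im < z.im + ε})) := by
    intro z
    have hsq : ∀ U ∈ 𝓝 z, ∃ ε > 0, ({w : ℂ | z.re - ε < w.re ∧ w.re < z.re + ε} ∩
        {w | z.im - ε < w.im ∧ w.im < z.im + ε}) ⊆ U := by
      intro U hU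
      obtain ⟨ε, hε, hb⟩ := Metric.mem_nhds_iff.1 hU
      refine ⟨ε / 2, half_pos hε, fun w hw => hb ?_⟩
      rw [Metric.mem_ball, dist_eq_norm]
      have h1 : |(w - z).re| < ε / 2 := by
        rw [abs_lt, Complex.sub_re]; constructor <;> linarith [hw.1.1, hw.1.2]
      have h2 : |(w - z).im| < ε / 2 := by
        rw [abs_lt, Complex.sub_im]; constructor <;> linarith [hw.2.1, hw.2.2]
      linarith [Complex.norm_le_abs_re_add_abs_im (w - z)]
    by_cases hz : z ∈ Metric.closedBall (0 : ℂ) 1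
    · obtain ⟨G, κ, ρ, hG, h0⟩ := exists_isFoldedChart (hns (φ.symm ⟨z, hz⟩))
      obtain ⟨g, hg⟩ := hG.exists_isDevelopingOn
      have hnhds : Metric.ball (G 0) ρ ∈ 𝓝 (φ.symm ⟨z, hz⟩) := by
        rw [h0]; exact Metric.ball_mem_nhds _ hG.pos
      rw [hind.nhds_eq_comap] at hnhds
      obtain ⟨U, hU, hUs⟩ := hnhds
      have hfz : f (φ.symm ⟨z, hz⟩) = z := by simp [hf]
      rw [hfz] at hU
      obtain ⟨ε, hε, hsub⟩ := hsq U hU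
      exact ⟨ε, hε, g, hg.mono ((preimage_mono hsub).trans hUs)⟩
    · obtain ⟨ε, hε, hsub⟩ := hsq _ (Metric.isClosed_closedBall.isOpen_compl.mem_nhds hz)
      exact ⟨ε, hε, fun _ => 0, fun p hp => absurd (φ p).2 (hsub hp)⟩
  have hcol : ∀ x : ℝ, ∃ δ > 0, ∃ g : D → ℂ, IsDevelopingOn g
      (f ⁻¹' {w | x - δ < w.re ∧ w.re < x + δ}) := by
    intro x
    -- The disk occupies only heights in `[-1, 1]`, so at `u = -2` the preimage is empty and at `u =
    -- 2` it is the whole column. The width `δ` may shrink as the height grows.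
    have key := continuous_induction (a := -2) (b := 2)
      (Q := fun u => ∃ δ > 0, ∃ g : D → ℂ, IsDevelopingOn g
        (f ⁻¹' ({w | x - δ < w.re ∧ w.re < x + δ} ∩ {w | -3 < w.im ∧ w.im < u}))) (by norm_num)
      ?_ ?_ ?_
    · obtain ⟨δ, hδ, g, hg⟩ := key
      refine ⟨δ, hδ, g, hg.mono fun y hy => ⟨hy, ?_⟩⟩
      have := abs_le.1 (himim y)
      constructor <;> linarith [this.1, this.2]
    · rintro u v huv ⟨δ, hδ, g, hg⟩
      exact ⟨δ, hδ, g, hg.mono fun y hy => ⟨hy.1, hy.2.1, hy.2.2.trans_le huv⟩⟩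
    · refine ⟨1, one_pos, fun _ => 0, fun y hy => ?_⟩
      have := abs_le.1 (himim y)
      linarith [hy.2.2, this.1]
    · intro u _ _ hlt
      obtain ⟨ε, hε, g', hg'⟩ := hrect ⟨x, u⟩
      simp only at hg'
      obtain ⟨δ, hδ, g, hg⟩ := hlt (u - ε / 2) (by linarith)
      have hm : 0 < min δ ε := lt_min hδ hε
      have b1 := min_le_left δ ε
      have b2 := min_le_right δ ε
      refine ⟨u + ε, by linarith, min δ ε, hm, ?_⟩
      obtain ⟨g'', hg''⟩ := exists_isDevelopingOn_union hns
        (V := f ⁻¹' ({w | x - min δ ε < w.re ∧ w.re < x + min δ ε} ∩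
          {w | -3 < w.im ∧ w.im < u - ε / 2}))
        (W := f ⁻¹' ({w | x - min δ ε < w.re ∧ w.re < x + min δ ε} ∩
          {w | u - ε < w.im ∧ w.im < u + ε}))
        (hopen _ ((hre _ _).1.inter (him _ _).1)) (hopen _ ((hre _ _).1.inter (him _ _).1))
        (by
          rw [← preimage_inter]
          exact hpre _ (((hre _ _).2.inter (him _ _).2).inter ((hre _ _).2.inter (him _ _).2)))
        ⟨g, hg.mono fun y hy => ⟨⟨by linarith [hy.1.1], by linarith [hy.1.2]⟩, hy.2⟩⟩
        ⟨g', hg'.mono fun y hy => ⟨⟨by linarith [hy.1.1], by linarith [hy.1.2]⟩, hy.2⟩⟩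
      refine ⟨g'', hg''.mono fun y hy => ?_⟩
      rcases lt_or_ge (f y).im (u - ε / 2) with h | h
      · exact Or.inl ⟨hy.1, hy.2.1, h⟩
      · exact Or.inr ⟨hy.1, by linarith, hy.2.2⟩
  have key := continuous_induction (a := -2) (b := 2)
    (Q := fun u => ∃ g : D → ℂ, IsDevelopingOn g (f ⁻¹' {w | -3 < w.re ∧ w.re < u}))
    (by norm_num) ?_ ?_ ?_
  · obtain ⟨g, hg⟩ := key
    refine ⟨g, hg.mono fun y _ => ?_⟩
    have := abs_le.1 (hrere y)
    constructor <;> linarith [this.1, this.2]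
  · rintro u v huv ⟨g, hg⟩
    exact ⟨g, hg.mono fun y hy => ⟨hy.1, hy.2.trans_le huv⟩⟩
  · refine ⟨fun _ => 0, fun y hy => ?_⟩
    have := abs_le.1 (hrere y)
    linarith [hy.2, this.1]
  · intro u _ _ hlt
    obtain ⟨ε, hε, hg'⟩ := hcol u
    obtain ⟨g'', hg''⟩ := exists_isDevelopingOn_union hns (hopen _ (hre _ _).1)
      (hopen _ (hre _ _).1)
      (by rw [← preimage_inter]; exact hpre _ ((hre _ _).2.inter (hre _ _).2))
      (hlt (u - ε / 2) (by linarith)) hg'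
    refine ⟨u + ε, by linarith, g'', hg''.mono fun y hy => ?_⟩
    rcases lt_or_ge (f y).re (u - ε / 2) with h | h
    · exact Or.inl ⟨hy.1, h⟩
    · exact Or.inr ⟨by linarith, hy.2⟩

/-- A compact space without singular points has no global developing map. -/
lemma not_isDevelopingOn_univ [CompactSpace D] [Nonempty D]
    (hns : ∀ x : D, ¬ IsSingularPoint x) (g : D → ℂ) :
    ¬ IsDevelopingOn g univ := by
  intro hg
  have hcont : Continuous g := by
    rw [continuous_iff_continuousAt]
    intro p
    obtain ⟨r, hr, hd⟩ := hg p trivial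
    rw [Metric.continuousAt_iff]
    intro ε hε
    refine ⟨min r ε, lt_min hr hε, fun y hy => ?_⟩
    rw [hd y p (hy.trans_le (min_le_left _ _)) (by simpa using hr)]
    exact hy.trans_le (min_le_right _ _)
  obtain ⟨p, -, hmax⟩ := isCompact_univ.exists_isMaxOn univ_nonempty hcont.norm.continuousOn
  obtain ⟨G, κ, ρ, hG, rfl⟩ := exists_isFoldedChart (hns p)
  obtain ⟨r, hr, hrρ, L, hL⟩ := hG.exists_eq_motion (hg.mono (subset_univ {G 0}))
  -- Being real, both `w` and `-w` are fixed by either model, so the image of `g` contains a segment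
  -- centred at `g (G 0)`. By the parallelogram law one of its ends has larger norm, against
  -- maximality.
  set w : ℂ := ((r / 2 : ℝ) : ℂ) with hw
  have hwn : ‖w‖ = r / 2 := by rw [hw, Complex.norm_real, Real.norm_of_nonneg (by positivity)]
  have h1 := hmax (mem_univ (G w))
  have h2 := hmax (mem_univ (G (-w)))
  simp only [mem_ofPred_eq] at h1 h2
  rw [hL w (by linarith), hG.model.eq_self (by simp [hw])] at h1
  rw [hL (-w) (by rw [norm_neg]; linarith), hG.model.eq_self (by simp [hw]), map_neg,
    ← sub_eq_add_neg] at h2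
  have h3 := parallelogram_law_with_norm ℝ (g (G 0)) (L w)
  rw [L.norm_map, hwn] at h3
  nlinarith [norm_nonneg (g (G 0)), norm_nonneg (g (G 0) + L w), norm_nonneg (g (G 0) - L w)]

/-- This takes the place of the Gauss–Bonnet formula. -/
lemma IsFlatDisk.exists_isSingularPoint (hD : IsFlatDisk D) : ∃ x : D, IsSingularPoint x := by
  by_contra! hns
  obtain ⟨φ⟩ := hD.homeomorph_disk
  have : CompactSpace D := φ.symm.compactSpace
  have : Nonempty D := ⟨φ.symm ⟨0, by simp⟩⟩
  obtain ⟨g, hg⟩ := exists_isDevelopingOn_univ hns φ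
  exact not_isDevelopingOn_univ hns g hg

end Developing

/-! ### Porous sets are null -/

/-- A set of reals which is porous at each of its points is a null set. -/
lemma volume_eq_zero_of_porous {S : Set ℝ} (h : ∀ x ∈ S, ∃ c > 0, ∀ η > 0, ∃ α > 0, α < η ∧
    ∃ w, |w - x| ≤ α ∧ ∀ ψ ∈ S, c * α ≤ |ψ - w|) : volume S = 0 := by
  rw [measure_eq_zero_iff_ae_notMem]
  have hdens := ae_imp_of_ae_restrict
    (Besicovitch.ae_tendsto_measure_inter_div (volume : Measure ℝ) S)
  filter_upwards [hdens] with x hx hxS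
  have hlim := hx hxS
  obtain ⟨c', hc', hpor'⟩ := h x hxS
  -- With `c ≤ 1` the gap about `w` lies in the ball of radius `2 * α` about `x`. It takes up the
  -- fraction `c / 2` of that ball, so the density of `S` at `x` cannot be `1`. The density theorem
  -- used needs no measurability of `S`.
  obtain ⟨c, hc, hc1, hpor⟩ : ∃ c > 0, c ≤ 1 ∧ ∀ η > 0, ∃ α > 0, α < η ∧
      ∃ w, |w - x| ≤ α ∧ ∀ ψ ∈ S, c * α ≤ |ψ - w| := by
    refine ⟨min c' 1, lt_min hc' one_pos, min_le_right _ _, fun η hη => ?_⟩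
    obtain ⟨α, hα, hαη, w, hw, hS⟩ := hpor' η hη
    refine ⟨α, hα, hαη, w, hw, fun ψ hψ => le_trans ?_ (hS ψ hψ)⟩
    exact mul_le_mul_of_nonneg_right (min_le_left _ _) hα.le
  have hlt : ENNReal.ofReal (1 - c / 2) < 1 := by
    rw [← ENNReal.ofReal_one]
    exact (ENNReal.ofReal_lt_ofReal_iff one_pos).2 (by linarith)
  obtain ⟨η, hη, hη'⟩ := mem_nhdsGT_iff_exists_Ioo_subset.1 (hlim.eventually (lt_mem_nhds hlt))
  obtain ⟨α, hα, hαη, w, hw, hS⟩ := hpor (η / 2) (half_pos hη)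
  have h2α : 2 * α ∈ Ioo 0 η := ⟨by positivity, by linarith⟩
  have hgt : ENNReal.ofReal (1 - c / 2) <
      volume (S ∩ Metric.closedBall x (2 * α)) / volume (Metric.closedBall x (2 * α)) := hη' h2α
  refine absurd hgt (not_lt.2 ?_)
  have hball : Metric.ball w (c * α) ⊆ Metric.closedBall x (2 * α) := by
    intro y hy
    rw [Metric.mem_ball, Real.dist_eq] at hy
    rw [Metric.mem_closedBall, Real.dist_eq]
    have := abs_sub_le y w x
    nlinarith
  have hsub : S ∩ Metric.closedBall x (2 * α) ⊆
      Metric.closedBall x (2 * α) \ Metric.ball w (c * α) := by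
    rintro y ⟨hyS, hy⟩
    exact ⟨hy, fun hyb => absurd (hS y hyS) (not_le.2 (by simpa [Real.dist_eq] using hyb))⟩
  have hvol : volume (S ∩ Metric.closedBall x (2 * α)) ≤ ENNReal.ofReal (4 * α - 2 * (c * α)) := by
    refine (measure_mono hsub).trans_eq ?_
    rw [measure_sdiff hball measurableSet_ball.nullMeasurableSet measure_ball_lt_top.ne,
      Real.volume_closedBall,
      Real.volume_ball, ← ENNReal.ofReal_sub _ (by positivity)]
    congr 1; ring
  rw [Real.volume_closedBall]
  refine ENNReal.div_le_of_le_mul (hvol.trans_eq ?_)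
  rw [← ENNReal.ofReal_mul (by linarith)]
  congr 1; ring

/-! ### Porosity of the far directions and the theorem -/

section Main

variable {D : Type*} [MetricSpace D] {e : ℝ → ℝ → D}

/-- A long thin flat sector contains a large flat disk. -/
lemma exists_hasFlatBall_of_lt_lifetime {φ α C : ℝ} (hα : 0 < α) (hα1 : α ≤ 1) (hC : 0 < C)
    (h : ∀ w, |w - φ| < α → ((C / α : ℝ) : EReal) < lifetime e w) :
    ∃ p : D, HasFlatBall p (C / 8) := by
  set F : ℂ → D := fun z => flow e ‖z‖ (φ + z.arg) with hF
  have hflat : ∀ z : ℂ, 0 < z.re → |z.arg| < α → ‖z‖ < C / α → FlatAt F z := by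
    intro z hre harg hnorm
    have hz : 0 < ‖z‖ := hre.trans_le (Complex.re_le_norm z)
    obtain ⟨f, hf, hev⟩ := (isFree_of_lt_lifetime (h (φ + z.arg) (by simpa using harg))).polarFlatAt
      ⟨hz, hnorm⟩
    have hrot : ∀ z : ℂ, ‖z‖ * unitVec (φ + z.arg) = unitVec φ * z := fun z => by
      rw [unitVec_add, mul_left_comm, norm_mul_unitVec_arg]
    obtain ⟨c, hc⟩ : ∃ c : Circle, (c : ℂ) = unitVec φ :=
      ⟨⟨unitVec φ, mem_sphere_zero_iff_norm.2 (norm_unitVec φ)⟩, rfl⟩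
    have hf' : FlatAt (fun x => f (0 + rotation c (x - 0))) z := by
      refine FlatAt.comp_motion ?_
      rw [hrot] at hf
      simpa [rotation_apply, hc] using hf
    refine hf'.congr ?_
    have hcont : Tendsto (fun x : ℂ => (‖x‖, φ + x.arg)) (𝓝 z) (𝓝 (‖z‖, φ + z.arg)) :=
      (continuous_norm.continuousAt.prodMk (continuousAt_const.add
        (Complex.continuousAt_arg (Or.inl hre)))).tendsto
    filter_upwards [hcont.eventually hev] with x hx
    change flow e ‖x‖ (φ + x.arg) = _
    rw [hx, hrot, zero_add, sub_zero, rotation_apply, hc]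
  -- The disk is centred halfway along the sector. Its points have imaginary part below `C / 8 = m *
  -- α / 4` and real part at least `3 * m / 4`, so the sine of their argument is less than `α / 2 <
  -- sin α`.
  set m : ℝ := C / (2 * α) with hm
  have hmα : m * α = C / 2 := by rw [hm]; field_simp
  have hmpos : 0 < m := by positivity
  have hCα : C / α = 2 * m := by rw [hm]; field_simp
  refine ⟨F m, fun z => F (m + z), by simp, fun z hz => FlatAt.comp_add (hflat _ ?_ ?_ ?_)⟩
  all_goals
    have hre := abs_le.1 ((Complex.abs_re_le_norm z).trans hz.le)
    have hm4 : C / 8 ≤ m / 4 := by nlinarith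
  · simp only [Complex.add_re, Complex.ofReal_re]; linarith [hre.1]
  · have hre' : m * (3 / 4) ≤ ((m : ℂ) + z).re := by
      simp only [Complex.add_re, Complex.ofReal_re]; linarith [hre.1]
    have him : |((m : ℂ) + z).im| < C / 8 := by
      simpa using (Complex.abs_im_le_norm z).trans_lt hz
    have hpos : 0 < ((m : ℂ) + z).re := by linarith
    have hnpos : 0 < ‖(m : ℂ) + z‖ := hpos.trans_le (Complex.re_le_norm _)
    have hsin : α / 2 < Real.sin α := by
      have := Real.sin_gt_sub_cube hα
      nlinarith [pow_le_pow_left₀ hα.le hα1 2]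
    have hratio : |((m : ℂ) + z).im / ‖(m : ℂ) + z‖| < Real.sin α := by
      rw [abs_div, abs_norm, div_lt_iff₀ hnpos]
      nlinarith [Complex.re_le_norm ((m : ℂ) + z)]
    rw [abs_lt] at hratio
    have hπ := Real.pi_gt_three
    rw [Complex.arg_of_re_nonneg hpos.le, abs_lt]
    constructor
    · rw [Real.lt_arcsin_iff_sin_lt' ⟨by linarith, by linarith⟩, Real.sin_neg]
      exact hratio.1
    · rw [Real.arcsin_lt_iff_lt_sin' ⟨by linarith, by linarith⟩]
      exact hratio.2
  · rw [hCα]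
    have := norm_add_le (m : ℂ) z
    rw [Complex.norm_real, Real.norm_of_nonneg hmpos.le] at this
    linarith

/-- Almost no trajectory stays away from the singular points. -/
lemma IsConeOrSectorChart.volume_far_eq_zero {p : D} {θ ρ : ℝ} (h : IsConeOrSectorChart p θ ρ e)
    (hD : IsFlatDisk D) {ε : ℝ} (hε : 0 < ε) :
    volume {φ | φ ∈ Ioo 0 θ ∧ ∀ t > 0, ∀ x, IsSingularPoint x → ε ≤ dist (flow e t φ) x} = 0 := by
  obtain ⟨Φ⟩ := hD.homeomorph_disk
  have : CompactSpace D := Φ.symm.compactSpace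
  have : PreconnectedSpace (Metric.closedBall (0 : ℂ) 1) :=
    Subtype.preconnectedSpace (convex_closedBall _ _).isPreconnected
  have : PreconnectedSpace D := Φ.symm.surjective.denseRange.preconnectedSpace Φ.symm.continuous
  refine volume_eq_zero_of_porous fun φ hφ => ?_
  -- If no `C` worked, there would be a flat disk of every radius `R`; the choice `C = 8 * max R 1`
  -- allows for the radius `C / 8`.
  obtain ⟨C, hC, hshort⟩ : ∃ C > 0, ∀ η > 0, ∃ α > 0, α < η ∧ ∃ w, |w - φ| < α ∧
      lifetime e w ≤ ((C / α : ℝ) : EReal) := by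
    by_contra! hcon
    obtain ⟨x, hx⟩ := hD.exists_isSingularPoint
    refine hD.not_isSingularPoint_of_hasFlatBall (fun R => ?_) x hx
    have hC : 0 < 8 * max R 1 := by positivity
    obtain ⟨η, hη, hlong⟩ := hcon _ hC
    have hα : 0 < min η 1 / 2 := by have := lt_min hη one_pos; positivity
    obtain ⟨p, hp⟩ := exists_hasFlatBall_of_lt_lifetime hα
      (by linarith [min_le_right η 1]) hC
      (hlong _ hα (by linarith [min_le_left η 1, lt_min hη one_pos]))
    exact ⟨p, hp.mono (by linarith [le_max_left R 1])⟩
  refine ⟨ε / C, by positivity, fun η hη => ?_⟩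
  obtain ⟨h0, hθ⟩ := hφ.1
  -- A scale below `φ` and `θ - φ` keeps `w` among the interior directions.
  obtain ⟨α, hα, hαη, w, hw, hlife⟩ := hshort (min η (min φ (θ - φ)))
    (lt_min hη (lt_min h0 (by linarith)))
  rw [lt_min_iff, lt_min_iff] at hαη
  have hw' := abs_lt.1 hw
  have hwm : w ∈ Ioo 0 θ := ⟨by linarith [hαη.2.1], by linarith [hαη.2.2]⟩
  refine ⟨α, hα, hαη.1, w, hw.le, fun ψ hψ => ?_⟩
  have := le_mul_abs_sub_of_lifetime_le h hψ.1 hwm hψ.2 hlife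
  rw [div_mul_eq_mul_div, le_div_iff₀ hα] at this
  rw [div_mul_eq_mul_div, div_le_iff₀ hC]
  linarith

/-- Every direction which points into the disk is that of a billiard trajectory. -/
lemma IsConeOrSectorChart.exists_isBilliardTrajectory [CompleteSpace D] {p : D} {θ ρ : ℝ}
    (h : IsConeOrSectorChart p θ ρ e) {φ : ℝ} (hφ : φ ∈ Ioo 0 θ) :
    ∃ (γ : ℝ → D) (T : EReal), IsBilliardTrajectory e φ γ T := by
  have hstart := (h.isFree hφ).start
  rcases lifetime_eq_top_or h hφ with htop | ⟨τ, hτ, hlife, x, hx, hlim⟩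
  · refine ⟨fun t => flow e t φ, ⊤, EReal.coe_lt_top 0, hstart, fun t ht _ => ?_,
      fun τ hτ => absurd hτ (EReal.coe_ne_top τ)⟩
    have : IsFree e φ (t + 1) := isFree_of_lt_lifetime (by rw [htop]; exact EReal.coe_lt_top _)
    exact isBilliardMotionAt_iff.2 (this.polarFlatAt ⟨ht, lt_add_one t⟩).flatMotionAt
  · have hlt : ∀ t < τ, (fun s => if s < τ then flow e s φ else x) =ᶠ[𝓝 t] fun s => flow e s φ := by
      intro t ht
      filter_upwards [Iio_mem_nhds ht] with s hs
      exact if_pos hs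
    refine ⟨fun s => if s < τ then flow e s φ else x, τ, EReal.coe_pos.2 hτ, ?_, fun t ht htτ => ?_,
      fun τ' hτ' => ?_⟩
    · filter_upwards [hstart, nhdsWithin_le_nhds (hlt 0 hτ)] with s h1 h2
      rw [h2, h1]
    · have htτ' := EReal.coe_lt_coe_iff.1 htτ
      obtain ⟨r, hr1, hr2⟩ := exists_between htτ'
      have : IsFree e φ r := isFree_of_lt_lifetime (by
        rw [hlife]; exact EReal.coe_lt_coe_iff.2 hr2)
      exact isBilliardMotionAt_iff.2
        ((this.polarFlatAt ⟨ht, hr1⟩).flatMotionAt.congr (hlt t htτ'))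
    · obtain rfl := EReal.coe_injective hτ'
      simp only [lt_irrefl, if_false]
      refine ⟨hx, hlim.congr' ?_⟩
      filter_upwards [self_mem_nhdsWithin] with s hs
      exact (if_pos hs).symm

/-- A folded chart is flat at all points of its disk, so regular points form an open set; finiteness
of the singular set is not needed. -/
lemma isClosed_setOf_isSingularPoint : IsClosed {x : D | IsSingularPoint x} := by
  rw [← isOpen_compl_iff, isOpen_iff_mem_nhds]
  intro x hx
  obtain ⟨g, κ, ρ, hg, rfl⟩ := exists_isFoldedChart hx
  filter_upwards [Metric.ball_mem_nhds _ hg.pos] with y hy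
  obtain ⟨w, hw, rfl⟩ := hg.surj y hy
  exact (hg.flatAt hw).not_isSingularPoint

/-- A trajectory whose closure contains no singular point stays away from them. -/
lemma IsBilliardTrajectory.exists_le_dist [CompactSpace D] {φ : ℝ} {γ : ℝ → D} {T : EReal}
    (h : IsBilliardTrajectory e φ γ T)
    (hsing : ∀ x ∈ closure (trajectoryRange γ T), ¬ IsSingularPoint x) :
    ∃ ε > 0, ∀ t > 0, ∀ x, IsSingularPoint x → ε ≤ dist (flow e t φ) x := by
  -- A trajectory of finite duration ends at a singular point, which belongs to its range.
  have hT : T = ⊤ := by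
    induction T with
    | bot => exact absurd h.pos not_lt_bot
    | top => rfl
    | coe τ =>
      exact absurd (h.singular_end τ rfl).1 (hsing _ (subset_closure
        ⟨τ, ⟨(EReal.coe_pos.1 h.pos).le, le_rfl⟩, rfl⟩))
  subst hT
  have hray : ∀ R, IsRay e φ R γ := fun R => ⟨h.start, fun t ht =>
    isBilliardMotionAt_iff.1 (h.motion t ht.1 (EReal.coe_lt_top t))⟩
  -- The compact closure of the trajectory is disjoint from the closed singular set, hence at
  -- positive distance from it.
  obtain ⟨ε, hε, hdisj⟩ := (isClosed_closure (s := trajectoryRange γ ⊤)).isCompact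
    |>.exists_thickening_subset_open isClosed_setOf_isSingularPoint.isOpen_compl
      fun x hx => hsing x hx
  refine ⟨ε, hε, fun t ht x hx => ?_⟩
  rw [(hray (t + 1)).flow_eq ht.le (lt_add_one t)]
  by_contra hlt
  refine hdisj (Metric.mem_thickening_iff.2 ⟨γ t, subset_closure ⟨t, ⟨ht.le, le_top⟩, rfl⟩, ?_⟩) hx
  rw [dist_comm]; exact not_le.1 hlt

end Main

/-- For every point `q` of a flat disk, whose directions are the angles `φ ∈ [0, θ]` of a polar
chart `e` at `q`, and for almost every direction `φ`, the billiard trajectory from `q` in the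
direction `φ` exists and has a singular point in its closure. -/
theorem mainTheorem1 {D : Type*} [MetricSpace D] (hD : IsFlatDisk D)
    (q : D) (θ ρ : ℝ) (e : ℝ → ℝ → D)
    (he : IsConeChart q θ ρ e ∨ IsSectorChart q θ ρ e) :
    ∀ᵐ φ ∂(volume.restrict (Icc 0 θ)),
      (∃ (γ : ℝ → D) (T : EReal), IsBilliardTrajectory e φ γ T) ∧
      ∀ (γ : ℝ → D) (T : EReal), IsBilliardTrajectory e φ γ T →
        ∃ x ∈ closure (trajectoryRange γ T), IsSingularPoint x := by
  obtain ⟨Φ⟩ := hD.homeomorph_disk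
  have : CompactSpace D := Φ.symm.compactSpace
  have hchart : IsConeOrSectorChart q θ ρ e := he
  have hfar : ∀ᵐ φ : ℝ, ∀ n : ℕ, φ ∉ {φ | φ ∈ Ioo 0 θ ∧
      ∀ t > 0, ∀ x, IsSingularPoint x → 1 / ((n : ℝ) + 1) ≤ dist (flow e t φ) x} :=
    ae_all_iff.2 fun n => measure_eq_zero_iff_ae_notMem.1
      (hchart.volume_far_eq_zero hD Nat.one_div_pos_of_nat)
  -- The directions `0` and `θ` form a null set and are discarded; for a boundary point they run
  -- along the boundary, where the chart has not been shown to be flat.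
  rw [← Measure.restrict_congr_set Ioo_ae_eq_Icc]
  filter_upwards [ae_restrict_mem measurableSet_Ioo, ae_restrict_of_ae hfar] with φ hφ hφfar
  refine ⟨hchart.exists_isBilliardTrajectory hφ, fun γ T hγ => ?_⟩
  by_contra! hsing
  obtain ⟨ε, hε, hle⟩ := hγ.exists_le_dist hsing
  obtain ⟨n, hn⟩ := exists_nat_one_div_lt hε
  exact hφfar n ⟨hφ, fun t ht x hx => hn.le.trans (hle t ht x hx)⟩
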